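/- Let $M$ be a complex manifold, $E$ a holomorphic vector bundle on $M$, $H$ the associated $C^\infty$ bundle and $d''$ its $\overline\partial$-operator, so that $E=\ker d''$. **Conventions.** A Hermitian form $h$ on $H$ is assumed to be $C^\infty$, sesquilinear, nondegenerate and Hermitian, but not necessarily positive definite; $P^\dagger$ denotes the $h$-adjoint of $P$, and $D=D'+d''$ the Chern connection of $h$. If $g$ is a nondegenerate symmetric bilinear form on $H$, $P^*$ denotes the $g$-adjoint of $P$. A Higgs field is a holomorphic one-form $\Phi:E\to\Omega^1_M\otimes E$ with $\Phi\wedge\Phi=0$. The triple $(E,h,\Phi)$ is a *harmonic Higgs bundle* if $\Phi$ is a Higgs field and the connection $D+\Phi+\Phi^\dagger$ on $H$ is integrable. A *holomorphic connection* is a connection $\nabla$ of type $(1,0)$ on $H$ with $d''\nabla+\nabla d''=0$. **Saito structures.** A Saito structure (of weight $0$) on $E$ is a tuple $(E,\nabla,g,\Phi,\mathcal U,\mathcal V)$, where $\nabla$ is a holomorphic connection, $g$ a nondegenerate symmetric holomorphic bilinear form, $\Phi$ a Higgs field, and $\mathcal U,\mathcal V$ are holomorphic endomorphisms of $E$, such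 that $$\nabla^2=0,\quad \nabla(\mathcal V)=0,\quad [\mathcal U,\Phi]=0,\quad \nabla(\Phi)=0,\quad \nabla(\mathcal U)-[\Phi,\mathcal V]+\Phi=0,$$ $$\nabla(g)=0,\quad \mathcal V^*+\mathcal V=0,\quad \Phi^*=\Phi,\quad \mathcal U^*=\mathcal U.$$ A *harmonic potential real Saito structure* $(E,\nabla,g,\Phi,\mathcal U,\mathcal V,\kappa,A^\dagger)$ is a Saito structure together with the following data. * An antilinear $C^\infty$ involution $\kappa$ of $H$ such that $g$ is real on $\ker(\kappa-\mathrm{Id})$, such that $D'(g)=0$, where $D'$ is the $(1,0)$-part of the Chern connection of the Hermitian form $h$ defined by $h(\cdot,\kappa\,\cdot)=g(\cdot,\cdot)$, and such that $(E,h,\Phi)$ is a harmonic Higgs bundle. * A $C^\infty$ endomorphism of $H$, written $A^\dagger$, such that $(A^\dagger)^*=A^\dagger$ and such that, with $D'_{A}:=\nabla-[A^\dagger,\Phi]$ and $\Psi:=d''A^\dagger$, one has $(D'_A)^2=0$, $D'_A(\Psi)=0$ and $\Psi\wedge\Psi=0$. These data are required to be compatible: $D'=D'_A$; the $h$-adjoint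 $\Phi^\dagger$ of $\Phi$ is $\Psi$; and $\mathcal Q^\dagger=\mathcal Q$, where $\mathcal Q:=\mathcal V+[A^\dagger,\mathcal U]$. **Potential $tt^*$ bundles.** A potential $tt^*$ bundle is a tuple $(E,h,A,\kappa,\mathcal U,\mathcal Q)$, where $h$ is a Hermitian form on $H$, $\kappa$ is an antilinear $C^\infty$ involution of $H$, and $A,\mathcal U,\mathcal Q$ are $C^\infty$ endomorphisms of $H$, such that $h(\kappa\,\cdot,\kappa\,\cdot)=\overline{h(\cdot,\cdot)}$ and $D(\kappa)=0$; $(E,h,\Phi)$ is a harmonic Higgs bundle, where $\Phi:=D'A$; and, $*$ being the adjoint with respect to the symmetric form $g(\cdot,\cdot):=h(\cdot,\kappa\,\cdot)$, $$A^*=A,\quad d''(\mathcal U)=0,\quad \mathcal Q^\dagger=\mathcal Q,\quad [\Phi,\mathcal U]=0,\quad D'(\mathcal U)-[\Phi,\mathcal Q]+\Phi=0,$$ $$D'(\mathcal Q)+[\Phi,\mathcal U^\dagger]=0,\quad \mathcal U^*=\mathcal U,\quad \mathcal Q^*+\mathcal Q=0.$$ To such an object one associates $g$ and $\Phi$ as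 above, $\nabla:=D'+[A^\dagger,\Phi]$ and $\mathcal V:=\mathcal Q-[A^\dagger,\mathcal U]$. **Proposition.** There is a one-to-one correspondence between harmonic potential real Saito structures $(E,\nabla,g,\Phi,\mathcal U,\mathcal V,\kappa,A^\dagger)$ on $E$ and potential $tt^*$ bundles $(E,h,A,\kappa,\mathcal U,\mathcal Q)$ whose associated $\nabla$ and $\mathcal V$ satisfy $\nabla^2=0$ and $\nabla(\mathcal V)=0$. It sends $(E,\nabla,g,\Phi,\mathcal U,\mathcal V,\kappa,A^\dagger)$ to $(E,h,A,\kappa,\mathcal U,\mathcal Q)$, where $h$ is defined by $h(\cdot,\kappa\,\cdot)=g(\cdot,\cdot)$, $A$ is the $h$-adjoint of $A^\dagger$ and $\mathcal Q=\mathcal V+[A^\dagger,\mathcal U]$. Its inverse sends $(E,h,A,\kappa,\mathcal U,\mathcal Q)$ to $(E,\nabla,g,\Phi,\mathcal U,\mathcal V,\kappa,A^\dagger)$, where $\nabla,g,\Phi,\mathcal V$ are the associated objects and $A^\dagger$ is the $h$-adjoint of $A$. -/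

import Mathlib

open scoped Manifold ContDiff Topology ComplexConjugate
open Bundle

namespace TTStar

set_option linter.unusedSectionVars false

section RealStructures

variable {V : Type*} [NormedAddCommGroup V] [NormedSpace ℂ V]
  {M : Type*} [TopologicalSpace M] [ChartedSpace V M]
  {F : Type*} [NormedAddCommGroup F] [NormedSpace ℂ F]
  {E : M → Type*} [TopologicalSpace (TotalSpace F E)] [∀ x, TopologicalSpace (E x)]
  [∀ x, AddCommGroup (E x)] [∀ x, Module ℂ (E x)] [FiberBundle F E]

theorem contMDiffOn_real {G : Type*} [NormedAddCommGroup G] [NormedSpace ℂ G] {f : M → G}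
    {s : Set M} (hf : ContMDiffOn 𝓘(ℂ, V) 𝓘(ℂ, G) ω f s) :
    ContMDiffOn 𝓘(ℝ, V) 𝓘(ℝ, G) ∞ f s := by
  intro x hx
  have h := hf x hx
  rw [contMDiffWithinAt_iff] at h ⊢
  exact ⟨h.1, (h.2.restrict_scalars ℝ).of_le le_top⟩

instance isManifold_real [IsManifold 𝓘(ℂ, V) ω M] : IsManifold 𝓘(ℝ, V) ∞ M := by
  refine isManifold_of_contDiffOn _ _ _ fun e e' he he' => ?_
  have h := (contDiffGroupoid ω 𝓘(ℂ, V)).compatible he he'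
  rw [contDiffGroupoid, mem_groupoid_of_pregroupoid] at h
  exact (h.1.restrict_scalars ℝ).of_le le_top

instance isLinear_real (e : Trivialization F (π F E)) [e.IsLinear ℂ] : e.IsLinear ℝ where
  linear x hx :=
    { map_add := (e.linear ℂ hx).map_add
      map_smul := fun c v => by
        have := (e.linear ℂ hx).map_smul (c : ℂ) v
        simpa using this }

theorem coordChangeL_real (e e' : Trivialization F (π F E)) [e.IsLinear ℂ] [e'.IsLinear ℂ] (b : M) :
    (e.coordChangeL ℝ e' b : F →L[ℝ] F) =
      ContinuousLinearMap.restrictScalars ℝ (e.coordChangeL ℂ e' b : F →L[ℂ] F) := by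
  ext v
  by_cases hb : b ∈ e.baseSet ∩ e'.baseSet
  · change e.coordChangeL ℝ e' b v = e.coordChangeL ℂ e' b v
    rw [Trivialization.coordChangeL_apply e e' hb, Trivialization.coordChangeL_apply e e' hb]
  · change e.coordChangeL ℝ e' b v = e.coordChangeL ℂ e' b v
    simp [Trivialization.coordChangeL, dif_neg hb]

instance vectorBundle_real [VectorBundle ℂ F E] : VectorBundle ℝ F E where
  trivialization_linear' e _ := inferInstance
  continuousOn_coordChange' e e' _ _ := by
    have := continuousOn_coordChange ℂ e e'
    simp_rw [coordChangeL_real]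
    exact (ContinuousLinearMap.restrictScalarsL ℂ F F ℝ ℝ).continuous.comp_continuousOn this

instance contMDiffVectorBundle_real [VectorBundle ℂ F E]
    [ContMDiffVectorBundle ω F E 𝓘(ℂ, V)] : ContMDiffVectorBundle ∞ F E 𝓘(ℝ, V) where
  contMDiffOn_coordChangeL e e' _ _ := by
    have := contMDiffOn_real (contMDiffOn_coordChangeL (IB := 𝓘(ℂ, V)) (n := ω) e e')
    have h2 : ContDiff ℝ ∞ (ContinuousLinearMap.restrictScalarsL ℂ F F ℝ ℝ) :=
      (ContinuousLinearMap.restrictScalarsL ℂ F F ℝ ℝ).contDiff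
    simp_rw [coordChangeL_real]
    exact h2.contMDiff.comp_contMDiffOn this

end RealStructures


section Derivatives

variable {V : Type*} [NormedAddCommGroup V] [NormedSpace ℂ V]
  {W : Type*} [AddCommGroup W] [Module ℂ W]
  {M : Type*} [TopologicalSpace M] [ChartedSpace V M]

/-- The `ℂ`-linear part of an `ℝ`-linear map between complex vector spaces. -/
noncomputable def part10 (L : V →ₗ[ℝ] W) : V →ₗ[ℂ] W where
  toFun v := (1 / 2 : ℂ) • (L v - Complex.I • L (Complex.I • v))
  map_add' v w := by
    simp only [smul_add, map_add]; module
  map_smul' c v := by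
    have h (c : ℂ) (v : V) : L (c • v) = c.re • L v + c.im • L (Complex.I • v) := by
      conv_lhs => rw [← Complex.re_add_im c]
      rw [add_smul, map_add, mul_smul, Complex.coe_smul, Complex.coe_smul, map_smul, map_smul]
    have h2 : L (Complex.I • c • v) = c.re • L (Complex.I • v) - c.im • L v := by
      rw [smul_smul, h (Complex.I * c) v]
      simp [sub_eq_add_neg, add_comm]
    simp only [RingHom.id_apply]
    rw [h2, h c v]
    conv_rhs => rw [← Complex.re_add_im c]
    simp only [← Complex.coe_smul]
    match_scalars
    · ring
    · linear_combination (1 / 2 * c.im : ℂ) * Complex.I_sq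

/-- The conjugate-linear part of an `ℝ`-linear map between complex vector spaces. -/
noncomputable def part01 (L : V →ₗ[ℝ] W) : V →ₗ⋆[ℂ] W where
  toFun v := (1 / 2 : ℂ) • (L v + Complex.I • L (Complex.I • v))
  map_add' v w := by
    simp only [smul_add, map_add]; module
  map_smul' c v := by
    have h (c : ℂ) (v : V) : L (c • v) = c.re • L v + c.im • L (Complex.I • v) := by
      conv_lhs => rw [← Complex.re_add_im c]
      rw [add_smul, map_add, mul_smul, Complex.coe_smul, Complex.coe_smul, map_smul, map_smul]
    have h2 : L (Complex.I • c • v) = c.re • L (Complex.I • v) - c.im • L v := by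
      rw [smul_smul, h (Complex.I * c) v]
      simp [sub_eq_add_neg, add_comm]
    rw [h2, h c v]
    conv_rhs => rw [← Complex.re_add_im c]
    simp only [← Complex.coe_smul, map_add, map_mul, Complex.conj_ofReal, Complex.conj_I]
    match_scalars
    · ring
    · linear_combination (1 / 2 * c.im : ℂ) * Complex.I_sq

theorem part10_add_part01 (L : V →ₗ[ℝ] W) (v : V) : part10 L v + part01 L v = L v := by
  simp only [part10, part01, LinearMap.coe_mk, AddHom.coe_mk]
  module

/-- The differential at `x` of a function with values in a normed space, as a real-linear map
on the tangent space `T_x M = V`. -/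
noncomputable def diff {G : Type*} [NormedAddCommGroup G] [NormedSpace ℝ G] (f : M → G) (x : M) :
    V →ₗ[ℝ] G :=
  (mvfderiv 𝓘(ℝ, V) f x).toLinearMap

/-- The `(1,0)`-part of the differential of a function. -/
noncomputable def del (f : M → ℂ) (x : M) : V →ₗ[ℂ] ℂ :=
  part10 (diff (V := V) f x)

/-- The `(0,1)`-part of the differential of a function. -/
noncomputable def delbar (f : M → ℂ) (x : M) : V →ₗ⋆[ℂ] ℂ :=
  part01 (diff (V := V) f x)

end Derivatives


section Bundles

variable (V : Type*) [NormedAddCommGroup V] [NormedSpace ℂ V]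
  (M : Type*) [TopologicalSpace M] [ChartedSpace V M] [IsManifold 𝓘(ℂ, V) ω M]
  (F : Type*) [NormedAddCommGroup F] [NormedSpace ℂ F]
  {X : Type*} [TopologicalSpace X] [ChartedSpace V X]
  (E : X → Type*) [TopologicalSpace (TotalSpace F E)] [∀ x, TopologicalSpace (E x)]
  [∀ x, AddCommGroup (E x)] [∀ x, Module ℂ (E x)] [FiberBundle F E]

/-- Smooth (real) vector fields on `M`. -/
abbrev VF := ContMDiffSection 𝓘(ℝ, V) V ∞ (TangentSpace 𝓘(ℝ, V) : M → Type _)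

/-- Smooth sections over the manifold of the `C^∞` bundle `H` associated with `E`. -/
abbrev Sec := ContMDiffSection 𝓘(ℝ, V) F ∞ E

end Bundles

section Dbar

variable {V : Type*} [NormedAddCommGroup V] [NormedSpace ℂ V]
  {M : Type*} [TopologicalSpace M] [ChartedSpace V M]
  {F : Type*} [NormedAddCommGroup F] [NormedSpace ℂ F]
  {E : M → Type*} [TopologicalSpace (TotalSpace F E)] [∀ x, TopologicalSpace (E x)]
  [∀ x, AddCommGroup (E x)] [∀ x, Module ℂ (E x)] [FiberBundle F E]

/-- The value of a vector field at `x`, in the model `V` of `T_x M`. -/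
noncomputable def VF.val [IsManifold 𝓘(ℂ, V) ω M] (X : VF V M) (x : M) : V := X x

theorem contMDiffAt_mvfderiv_apply [IsManifold 𝓘(ℂ, V) ω M] {f : M → F} {x₀ : M} (hf : ContMDiffAt 𝓘(ℝ, V) 𝓘(ℝ, F) ∞ f x₀)
    (X : VF V M) :
    ContMDiffAt 𝓘(ℝ, V) 𝓘(ℝ, F) ∞ (fun x => diff (V := V) f x (X.val x)) x₀ := by
  have h1 := hf.mfderiv_const (m := ∞) (by simp)
  have h2 := h1.clm_apply_of_inCoordinates (X.contMDiff x₀) hf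
  exact (contMDiff_snd_tangentBundle_modelSpace F 𝓘(ℝ, F)).contMDiffAt.comp x₀ h2

/-- Multiplication of a vector field by `i`. -/
noncomputable def VF.J [IsManifold 𝓘(ℂ, V) ω M] (X : VF V M) : VF V M where
  toFun x := (Complex.I • X.val x : V)
  contMDiff_toFun := by
    intro x₀
    refine (contMDiffAt_section x₀).2 ?_
    have h := (contMDiffAt_section x₀).1 (X.contMDiff x₀)
    have hI : ContDiff ℝ ∞ (fun v : V => Complex.I • v) := contDiff_const_smul _
    refine (hI.contMDiff.contMDiffAt.comp x₀ h).congr_of_eventuallyEq ?_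
    filter_upwards [(chartAt V x₀).open_source.mem_nhds (mem_chart_source V x₀)] with y hy
    simp only [Function.comp, TangentBundle.trivializationAt_apply]
    have hd : DifferentiableAt ℂ ((chartAt V x₀) ∘ (chartAt V y).symm) (chartAt V y y) := by
      have h1 : ContMDiffAt 𝓘(ℂ, V) 𝓘(ℂ, V) ω (chartAt V x₀) y :=
        contMDiffOn_chart.contMDiffAt ((chartAt V x₀).open_source.mem_nhds hy)
      have h2 : ContMDiffAt 𝓘(ℂ, V) 𝓘(ℂ, V) ω (chartAt V y).symm (chartAt V y y) :=
        contMDiffOn_chart_symm.contMDiffAt ((chartAt V y).open_target.mem_nhds (mem_chart_target V y))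
      have h3 := ContMDiffAt.comp (I' := 𝓘(ℂ, V)) (chartAt V y y)
        (by simpa using h1) h2
      exact h3.contDiffAt.differentiableAt (by simp)
    have he := hd.fderiv_restrictScalars ℝ
    simp only [mfld_simps, fderivWithin_univ]
    change fderiv ℝ ((chartAt V x₀) ∘ (chartAt V y).symm) (chartAt V y y) _ = Complex.I • fderiv ℝ ((chartAt V x₀) ∘ (chartAt V y).symm) (chartAt V y y) _
    rw [he]
    simp only [ContinuousLinearMap.coe_restrictScalars']
    exact map_smul _ _ _

/-- The section `s` read in the (holomorphic) preferred trivialization at `x₀`. -/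
noncomputable def localRep (x₀ : M) (s : ∀ x, E x) (y : M) : F := (trivializationAt F E x₀ ⟨y, s y⟩).2

/-- The operator `d''` -/
noncomputable def dbarAt [VectorBundle ℂ F E] (s : ∀ x, E x) (x : M) :
    V →ₗ⋆[ℂ] E x :=
  ((trivializationAt F E x).symmₗ ℂ x).comp
    (part01 (diff (V := V) (localRep (F := F) x s) x))


theorem mvfderiv_eq_fderiv {G : Type*} [NormedAddCommGroup G] [NormedSpace ℝ G] {f : M → G} {x : M}
    (hf : MDifferentiableAt 𝓘(ℝ, V) 𝓘(ℝ, G) f x) (v : V) :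
    diff (V := V) f x v = fderiv ℝ (f ∘ (chartAt V x).symm) (chartAt V x x) v := by
  have h : mfderiv 𝓘(ℝ, V) 𝓘(ℝ, G) f x = fderiv ℝ (f ∘ (chartAt V x).symm) (chartAt V x x) := by
    rw [hf.mfderiv]
    simp only [mfld_simps, fderivWithin_univ]
    rfl
  change mfderiv 𝓘(ℝ, V) 𝓘(ℝ, G) f x v = _
  rw [h]
  rfl
theorem mdiff_chart {G : Type*} [NormedAddCommGroup G] [NormedSpace ℝ G] {f : M → G} {x : M}
    (hf : MDifferentiableAt 𝓘(ℝ, V) 𝓘(ℝ, G) f x) :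
    DifferentiableAt ℝ (f ∘ (chartAt V x).symm) (chartAt V x x) := by
  have h := hf.2
  simp only [DifferentiableWithinAtProp, mfld_simps, differentiableWithinAt_univ] at h
  exact h

theorem mvfderiv_bilin {G₁ G₂ G₃ : Type*} [NormedAddCommGroup G₁] [NormedSpace ℝ G₁]
    [NormedAddCommGroup G₂] [NormedSpace ℝ G₂] [NormedAddCommGroup G₃] [NormedSpace ℝ G₃]
    (B : G₁ →L[ℝ] G₂ →L[ℝ] G₃) {f : M → G₁} {g : M → G₂} {x : M}
    (hf : MDifferentiableAt 𝓘(ℝ, V) 𝓘(ℝ, G₁) f x) (hg : MDifferentiableAt 𝓘(ℝ, V) 𝓘(ℝ, G₂) g x) (v : V) :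
    diff (V := V) (fun y => B (f y) (g y)) x v =
      B (diff (V := V) f x v) (g x) + B (f x) (diff (V := V) g x v) := by
  have hfg : MDifferentiableAt 𝓘(ℝ, V) 𝓘(ℝ, G₃) (fun y => B (f y) (g y)) x := by
    have h1 : MDifferentiableAt 𝓘(ℝ, V) 𝓘(ℝ, G₂ →L[ℝ] G₃) (fun y => B (f y)) x :=
      B.differentiableAt.comp_mdifferentiableAt hf
    exact h1.clm_apply hg
  rw [mvfderiv_eq_fderiv hf, mvfderiv_eq_fderiv hg, mvfderiv_eq_fderiv hfg]
  have h1 := (mdiff_chart hf).hasFDerivAt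
  have h2 := (mdiff_chart hg).hasFDerivAt
  have h3 := (B.hasFDerivAt.comp _ h1).clm_apply h2
  have h4 : ((fun y => B (f y) (g y)) ∘ (chartAt V x).symm) = 
    fun y => (B ∘ f ∘ (chartAt V x).symm) y ((g ∘ (chartAt V x).symm) y) := rfl
  rw [h4, h3.fderiv]
  simp [add_comm]

theorem mvfderiv_complexLinear {G : Type*} [NormedAddCommGroup G] [NormedSpace ℂ G] {f : M → G} {x : M}
    (hf : MDifferentiableAt 𝓘(ℂ, V) 𝓘(ℂ, G) f x) (v : V) :
    diff (V := V) f x (Complex.I • v : V) = Complex.I • diff (V := V) f x v := by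
  have h0 : DifferentiableAt ℂ (f ∘ (chartAt V x).symm) (chartAt V x x) := by
    have h := hf.2
    simp only [DifferentiableWithinAtProp, mfld_simps, differentiableWithinAt_univ] at h
    exact h
  have h1 : MDifferentiableAt 𝓘(ℝ, V) 𝓘(ℝ, G) f x := by
    rw [mdifferentiableAt_iff]
    refine ⟨hf.continuousAt, ?_⟩
    simp only [mfld_simps, differentiableWithinAt_univ]
    exact h0.restrictScalars ℝ
  rw [mvfderiv_eq_fderiv h1, mvfderiv_eq_fderiv h1, h0.fderiv_restrictScalars ℝ]
  simp


theorem mvfderiv_congr {G : Type*} [NormedAddCommGroup G] [NormedSpace ℝ G] {f g : M → G} {x : M}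
    (h : f =ᶠ[𝓝 x] g) : diff (V := V) f x = diff (V := V) g x := by
  refine LinearMap.ext fun v => ?_
  change mfderiv 𝓘(ℝ, V) 𝓘(ℝ, G) f x v = mfderiv 𝓘(ℝ, V) 𝓘(ℝ, G) g x v
  rw [h.mfderiv_eq]
  rfl

section

variable [VectorBundle ℂ F E]

theorem localRep_add (x₀ : M) {x : M} (hx : x ∈ (trivializationAt F E x₀).baseSet)
    (s t : ∀ x, E x) :
    localRep (F := F) x₀ (s + t) x = localRep (F := F) x₀ s x + localRep (F := F) x₀ t x :=
  ((trivializationAt F E x₀).linear ℂ hx).map_add _ _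

theorem localRep_smul (x₀ : M) {x : M} (hx : x ∈ (trivializationAt F E x₀).baseSet)
    (f : M → ℂ) (s : ∀ x, E x) :
    localRep (F := F) x₀ (fun y => f y • s y) x = f x • localRep (F := F) x₀ s x :=
  ((trivializationAt F E x₀).linear ℂ hx).map_smul _ _

theorem symm_localRep (x₀ : M) {x : M} (hx : x ∈ (trivializationAt F E x₀).baseSet)
    (s : ∀ x, E x) : (trivializationAt F E x₀).symm x (localRep (F := F) x₀ s x) = s x :=
  (trivializationAt F E x₀).symm_apply_apply_mk hx _

variable [ContMDiffVectorBundle ω F E 𝓘(ℂ, V)]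

/-- A section is smooth at `x` iff its representative in a trivialization containing `x` is. -/
theorem contMDiffAt_iff_localRep (x₀ : M) {x : M} (hx : x ∈ (trivializationAt F E x₀).baseSet)
    (s : ∀ x, E x) :
    ContMDiffAt 𝓘(ℝ, V) (𝓘(ℝ, V).prod 𝓘(ℝ, F)) ∞ (fun y => TotalSpace.mk' F y (s y)) x ↔
      ContMDiffAt 𝓘(ℝ, V) 𝓘(ℝ, F) ∞ (localRep (F := F) x₀ s) x :=
  (trivializationAt F E x₀).contMDiffAt_section_iff hx

/-- The operator `d''` may be computed in any of the preferred trivializations. -/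
theorem dbarAt_eq (x₀ : M) {x : M} (hx : x ∈ (trivializationAt F E x₀).baseSet)
    (s : ∀ x, E x)
    (hs : ContMDiffAt 𝓘(ℝ, V) (𝓘(ℝ, V).prod 𝓘(ℝ, F)) ∞ (fun y => TotalSpace.mk' F y (s y)) x)
    (v : V) :
    dbarAt (F := F) s x v = (trivializationAt F E x₀).symmₗ ℂ x
      (part01 (diff (V := V) (localRep (F := F) x₀ s) x) v) := by
  set e₀ := trivializationAt F E x₀ with he₀
  set e := trivializationAt F E x with he
  have hxe : x ∈ e.baseSet := mem_baseSet_trivializationAt F E x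
  set C : M → F →L[ℂ] F := fun y => (e₀.coordChangeL ℂ e y : F →L[ℂ] F) with hC
  have hCx : MDifferentiableAt 𝓘(ℂ, V) 𝓘(ℂ, F →L[ℂ] F) C x :=
    ((contMDiffOn_coordChangeL (IB := 𝓘(ℂ, V)) (n := ω) e₀ e).contMDiffAt
      ((e₀.open_baseSet.inter e.open_baseSet).mem_nhds ⟨hx, hxe⟩)).mdifferentiableAt (by simp)
  have hCr : MDifferentiableAt 𝓘(ℝ, V) 𝓘(ℝ, F →L[ℂ] F) C x :=
    ((contMDiffOn_real (contMDiffOn_coordChangeL (IB := 𝓘(ℂ, V)) (n := ω) e₀ e)).contMDiffAt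
      ((e₀.open_baseSet.inter e.open_baseSet).mem_nhds ⟨hx, hxe⟩)).mdifferentiableAt (by simp)
  have hσ : MDifferentiableAt 𝓘(ℝ, V) 𝓘(ℝ, F) (localRep (F := F) x₀ s) x :=
    ((contMDiffAt_iff_localRep x₀ hx s).1 hs).mdifferentiableAt (by simp)
  let B : (F →L[ℂ] F) →L[ℝ] F →L[ℝ] F := ContinuousLinearMap.restrictScalarsL ℂ F F ℝ ℝ
  have hrep : localRep (F := F) x s =ᶠ[𝓝 x] fun y => B (C y) (localRep (F := F) x₀ s y) := by
    filter_upwards [(e₀.open_baseSet.inter e.open_baseSet).mem_nhds ⟨hx, hxe⟩] with y hy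
    change _ = e₀.coordChangeL ℂ e y (localRep (F := F) x₀ s y)
    rw [Trivialization.coordChangeL_apply e₀ e hy, symm_localRep x₀ hy.1]
    rfl
  have hd (w : V) : diff (V := V) (localRep (F := F) x s) x w =
      diff (V := V) C x w (localRep (F := F) x₀ s x) +
        C x (diff (V := V) (localRep (F := F) x₀ s) x w) := by
    rw [mvfderiv_congr hrep, mvfderiv_bilin B hCr hσ w]
    rfl
  have hI (w : V) : diff (V := V) C x (Complex.I • w : V) =
      Complex.I • diff (V := V) C x w := mvfderiv_complexLinear hCx w
  have h01 : part01 (diff (V := V) (localRep (F := F) x s) x) v =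
      C x (part01 (diff (V := V) (localRep (F := F) x₀ s) x) v) := by
    simp only [part01, LinearMap.coe_mk, AddHom.coe_mk]
    rw [hd, hd, hI]
    simp only [map_smul, map_add, smul_add, smul_apply]
    match_scalars <;> simp
  change e.symmₗ ℂ x (part01 (diff (V := V) (localRep (F := F) x s) x) v) = _
  rw [h01]
  change e.symmₗ ℂ x (e₀.coordChangeL ℂ e x _) = _
  rw [Trivialization.coordChangeL_apply e₀ e ⟨hx, hxe⟩, e.symmₗ_apply hxe, e.symm_apply_apply_mk hxe,
    e₀.symmₗ_apply hx]

end
end Dbar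


section Sections

variable {V : Type*} [NormedAddCommGroup V] [NormedSpace ℂ V]
  {M : Type*} [TopologicalSpace M] [ChartedSpace V M]
  {F : Type*} [NormedAddCommGroup F] [NormedSpace ℂ F]
  {E : M → Type*} [TopologicalSpace (TotalSpace F E)] [∀ x, TopologicalSpace (E x)]
  [∀ x, AddCommGroup (E x)] [∀ x, Module ℂ (E x)] [FiberBundle F E]
  [VectorBundle ℂ F E] [ContMDiffVectorBundle ω F E 𝓘(ℂ, V)]

theorem contMDiff_cmul {f g : M → ℂ} {x : M} (hf : ContMDiffAt 𝓘(ℝ, V) 𝓘(ℝ, ℂ) ∞ f x)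
    (hg : ContMDiffAt 𝓘(ℝ, V) 𝓘(ℝ, ℂ) ∞ g x) :
    ContMDiffAt 𝓘(ℝ, V) 𝓘(ℝ, ℂ) ∞ (fun y => f y * g y) x := by
  have h : ContDiff ℝ ∞ (fun p : ℂ × ℂ => p.1 * p.2) := contDiff_fst.mul contDiff_snd
  exact h.contMDiff.contMDiffAt.comp x (hf.prodMk_space hg)

/-- The product of a section with a complex-valued function. -/
theorem contMDiffAt_smul_sec {f : M → ℂ} {s : ∀ x, E x} {x : M}
    (hf : ContMDiffAt 𝓘(ℝ, V) 𝓘(ℝ, ℂ) ∞ f x)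
    (hs : ContMDiffAt 𝓘(ℝ, V) (𝓘(ℝ, V).prod 𝓘(ℝ, F)) ∞ (fun y => TotalSpace.mk' F y (s y)) x) :
    ContMDiffAt 𝓘(ℝ, V) (𝓘(ℝ, V).prod 𝓘(ℝ, F)) ∞ (fun y => TotalSpace.mk' F y (f y • s y)) x := by
  have hx := mem_baseSet_trivializationAt F E x
  rw [contMDiffAt_iff_localRep x hx] at hs ⊢
  have h : ContDiff ℝ ∞ (fun p : ℂ × F => p.1 • p.2) := contDiff_fst.smul contDiff_snd
  refine (h.contMDiff.contMDiffAt.comp x (hf.prodMk_space hs)).congr_of_eventuallyEq ?_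
  filter_upwards [(trivializationAt F E x).open_baseSet.mem_nhds hx] with y hy
  exact localRep_smul x hy f s

/-- The product of a smooth section with a smooth complex-valued function. -/
noncomputable def Sec.fsmul (f : M → ℂ) (hf : ContMDiff 𝓘(ℝ, V) 𝓘(ℝ, ℂ) ∞ f) (s : Sec V F E) : Sec V F E where
  toFun x := f x • s x
  contMDiff_toFun x := contMDiffAt_smul_sec (hf x) (s.contMDiff x)

@[simp] theorem Sec.fsmul_apply (f : M → ℂ) (hf : ContMDiff 𝓘(ℝ, V) 𝓘(ℝ, ℂ) ∞ f) (s : Sec V F E)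
    (x : M) : s.fsmul f hf x = f x • s x := rfl

variable [IsManifold 𝓘(ℂ, V) ω M] [FiniteDimensional ℂ V] [T2Space M]

/-- There is a smooth cut-off function near every point, supported in a given neighbourhood. -/
theorem exists_cutoff (x₀ : M) {u : Set M} (hu : u ∈ 𝓝 x₀) : ∃ χ : M → ℝ,
    ContMDiff 𝓘(ℝ, V) 𝓘(ℝ, ℝ) ∞ χ ∧ tsupport χ ⊆ u ∧ χ =ᶠ[𝓝 x₀] 1 := by
  have : FiniteDimensional ℝ V := FiniteDimensional.complexToReal V
  obtain ⟨f, -, hf⟩ := (SmoothBumpFunction.nhds_basis_tsupport (I := 𝓘(ℝ, V)) x₀).mem_iff.1 hu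
  exact ⟨f, f.contMDiff, hf, f.eventuallyEq_one⟩

theorem exists_cutoff_sec (F : Type*) [NormedAddCommGroup F] [NormedSpace ℂ F]
    (E : M → Type*) [TopologicalSpace (TotalSpace F E)] [∀ x, TopologicalSpace (E x)]
    [FiberBundle F E] (x₀ : M) : ∃ χ : M → ℝ,
    ContMDiff 𝓘(ℝ, V) 𝓘(ℝ, ℝ) ∞ χ ∧ tsupport χ ⊆ (trivializationAt F E x₀).baseSet ∧
      χ =ᶠ[𝓝 x₀] 1 :=
  exists_cutoff x₀ ((trivializationAt F E x₀).open_baseSet.mem_nhds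
    (mem_baseSet_trivializationAt F E x₀))

variable (V F E) in
/-- A cut-off function near `x₀`, supported in the domain of the preferred trivialization. -/
noncomputable def cutoff (x₀ : M) : M → ℝ := (exists_cutoff_sec (V := V) F E x₀).choose

theorem cutoff_contMDiff (x₀ : M) : ContMDiff 𝓘(ℝ, V) 𝓘(ℝ, ℝ) ∞ (cutoff V F E x₀) :=
  (exists_cutoff_sec (V := V) F E x₀).choose_spec.1

theorem cutoff_tsupport (x₀ : M) :
    tsupport (cutoff V F E x₀) ⊆ (trivializationAt F E x₀).baseSet :=
  (exists_cutoff_sec (V := V) F E x₀).choose_spec.2.1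

theorem cutoff_eq_one (x₀ : M) : cutoff V F E x₀ =ᶠ[𝓝 x₀] 1 :=
  (exists_cutoff_sec (V := V) F E x₀).choose_spec.2.2

variable (V E) in
/-- The section which is the constant `w` in the preferred trivialization at `x₀`,
multiplied by a cut-off function. -/
noncomputable def frameSec (x₀ : M) (w : F) : Sec V F E where
  toFun x := cutoff V F E x₀ x • (trivializationAt F E x₀).symmₗ ℂ x w
  contMDiff_toFun := by
    refine ContMDiffOn.smul_section_of_tsupport (cutoff_contMDiff x₀).contMDiffOn
      (trivializationAt F E x₀).open_baseSet (cutoff_tsupport x₀) fun x hx => ?_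
    refine ContMDiffAt.contMDiffWithinAt ?_
    refine (contMDiffAt_iff_localRep x₀ hx _).2 ?_
    refine (contMDiffAt_const (c := w)).congr_of_eventuallyEq ?_
    filter_upwards [(trivializationAt F E x₀).open_baseSet.mem_nhds hx] with y hy
    change ((trivializationAt F E x₀) ⟨y, (trivializationAt F E x₀).symmₗ ℂ y w⟩).2 = w
    rw [(trivializationAt F E x₀).symmₗ_apply hy, (trivializationAt F E x₀).apply_mk_symm hy]

theorem frameSec_apply (x₀ x : M) (w : F) : frameSec V E x₀ w x =
    (cutoff V F E x₀ x : ℂ) • (trivializationAt F E x₀).symmₗ ℂ x w := by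
  rw [Complex.coe_smul]; rfl

theorem frameSec_eventuallyEq (x₀ : M) (w : F) : ∀ᶠ x in 𝓝 x₀,
    frameSec V E x₀ w x = (trivializationAt F E x₀).symmₗ ℂ x w := by
  filter_upwards [cutoff_eq_one (V := V) (F := F) (E := E) x₀] with x hx
  rw [frameSec_apply, hx]
  simp

variable (V F) in
/-- A section with a given value at `x₀`. -/
noncomputable def extSec {x₀ : M} (u : E x₀) : Sec V F E :=
  frameSec V E x₀ ((trivializationAt F E x₀).linearMapAt ℂ x₀ u)

theorem extSec_apply_self {x₀ : M} (u : E x₀) : extSec V F u x₀ = u := by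
  rw [extSec, (frameSec_eventuallyEq x₀ _).self_of_nhds,
    (trivializationAt F E x₀).symmₗ_linearMapAt (mem_baseSet_trivializationAt F E x₀)]

theorem extSec_add {x₀ : M} (u v : E x₀) : extSec V F (u + v) = extSec V F u + extSec V F v := by
  ext x
  change frameSec V E x₀ _ x = frameSec V E x₀ _ x + frameSec V E x₀ _ x
  simp only [frameSec_apply, map_add, smul_add]

theorem extSec_smul {x₀ : M} (c : ℂ) (u : E x₀) :
    extSec V F (c • u) = (extSec V F u).fsmul (fun _ => c) contMDiff_const := by
  ext x
  change frameSec V E x₀ _ x = c • frameSec V E x₀ _ x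
  simp only [frameSec_apply, map_smul, smul_comm c]

/-- A property of sections holds for the sections vanishing at `x₀` as soon as it is stable under
sums and holds for the products of a section with a function vanishing at `x₀`. -/
theorem Sec.vanish_induction [FiniteDimensional ℂ F] (P : Sec V F E → Prop) (x₀ : M)
    (hadd : ∀ s t, P s → P t → P (s + t))
    (hsmul : ∀ (f : M → ℂ) (hf : ContMDiff 𝓘(ℝ, V) 𝓘(ℝ, ℂ) ∞ f) (s : Sec V F E), f x₀ = 0 →
      P (s.fsmul f hf)) (s : Sec V F E) (hs : s x₀ = 0) : P s := by
  classical
  let e := trivializationAt F E x₀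
  let b := Module.finBasis ℂ F
  let χ : M → ℝ := cutoff V F E x₀
  have hχ : ContMDiff 𝓘(ℝ, V) 𝓘(ℝ, ℝ) ∞ χ := cutoff_contMDiff x₀
  have hχc : ContMDiff 𝓘(ℝ, V) 𝓘(ℝ, ℂ) ∞ (fun x => (χ x : ℂ)) :=
    Complex.ofRealCLM.contDiff.contMDiff.comp hχ
  have hx₀ : x₀ ∈ e.baseSet := mem_baseSet_trivializationAt F E x₀
  -- the coefficients, cut off
  let c (i : Fin (Module.finrank ℂ F)) : M → ℂ := fun x => χ x • b.coord i (localRep (F := F) x₀ s x)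
  have hc (i) : ContMDiff 𝓘(ℝ, V) 𝓘(ℝ, ℂ) ∞ (c i) := by
    refine contMDiff_of_tsupport fun x hx => ?_
    have hxe : x ∈ e.baseSet := by
      refine cutoff_tsupport (V := V) x₀ (closure_mono ?_ hx)
      intro y hy hy0
      exact hy (by simp only [c]; rw [show χ y = 0 from hy0, zero_smul])
    have h1 := (contMDiffAt_iff_localRep x₀ hxe s).1 (s.contMDiff x)
    let l : F →L[ℝ] ℂ := ((b.coord i).toContinuousLinearMap).restrictScalars ℝ
    have h2 : ContMDiffAt 𝓘(ℝ, V) 𝓘(ℝ, ℂ) ∞ (fun x => l (localRep (F := F) x₀ s x)) x :=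
      l.contDiff.contMDiff.contMDiffAt.comp x h1
    exact (hχ x).smul h2
  have hc0 (i) : c i x₀ = 0 := by
    have : localRep (F := F) x₀ s x₀ = 0 := by
      change (e ⟨x₀, s x₀⟩).2 = 0
      rw [hs]
      exact (e.linear ℂ hx₀).map_zero
    simp [c, this]
  have hzero : P 0 := by
    have := hsmul (fun _ => 0) contMDiff_const s rfl
    convert this
    ext x
    simp
  have hsum (t : Finset (Fin (Module.finrank ℂ F))) :
      P (∑ i ∈ t, (frameSec V E x₀ (b i)).fsmul (c i) (hc i)) := by
    induction t using Finset.induction_on with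
    | empty => simpa using hzero
    | insert i t hi ih =>
      rw [Finset.sum_insert hi]
      exact hadd _ _ (hsmul _ _ _ (hc0 i)) ih
  have h1 : ContMDiff 𝓘(ℝ, V) 𝓘(ℝ, ℂ) ∞ (fun x => 1 - (χ x : ℂ) * (χ x : ℂ)) :=
    contMDiff_const.sub fun x => contMDiff_cmul (hχc x) (hχc x)
  have hdec : s = s.fsmul _ h1 + ∑ i, (frameSec V E x₀ (b i)).fsmul (c i) (hc i) := by
    ext x
    have hco (t : Finset (Fin (Module.finrank ℂ F))) :
        (∑ i ∈ t, (frameSec V E x₀ (b i)).fsmul (c i) (hc i)) x =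
        ∑ i ∈ t, c i x • frameSec V E x₀ (b i) x := by
      induction t using Finset.induction_on with
      | empty => rfl
      | insert i t hi ih =>
        rw [Finset.sum_insert hi, Finset.sum_insert hi, ← ih]; rfl
    rw [ContMDiffSection.coe_add, Pi.add_apply, hco, Sec.fsmul_apply]
    by_cases hx : x ∈ e.baseSet
    · have h2 : ∑ i, c i x • frameSec V E x₀ (b i) x = ((χ x : ℂ) * (χ x : ℂ)) • s x := by
        have h3 : s x = e.symmₗ ℂ x (∑ i, b.coord i (localRep (F := F) x₀ s x) • b i) := by
          simp only [Module.Basis.coord_apply, b.sum_repr]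
          rw [e.symmₗ_apply hx, symm_localRep x₀ hx]
        conv_rhs => rw [h3]
        rw [map_sum, Finset.smul_sum]
        refine Finset.sum_congr rfl fun i _ => ?_
        rw [frameSec_apply, map_smul, smul_smul, smul_smul]
        congr 1
        simp only [c, Complex.real_smul]
        change _ = (χ x : ℂ) * (χ x : ℂ) * _
        change _ * (χ x : ℂ) = _
        ring
      rw [h2, ← add_smul]
      simp
    · have h0 : χ x = 0 := by
        by_contra h
        exact hx (cutoff_tsupport (V := V) x₀ (subset_tsupport _ h))
      simp [h0, c]
  rw [hdec]
  exact hadd _ _ (hsmul _ _ _ (by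
    have : χ x₀ = 1 := (cutoff_eq_one (V := V) (F := F) (E := E) x₀).self_of_nhds
    simp [this])) (hsum _)

end Sections


section Operators

variable {V : Type*} [NormedAddCommGroup V] [NormedSpace ℂ V]
  {M : Type*} [TopologicalSpace M] [ChartedSpace V M]
  {F : Type*} [NormedAddCommGroup F] [NormedSpace ℂ F]
  {E : M → Type*} [TopologicalSpace (TotalSpace F E)] [∀ x, TopologicalSpace (E x)]
  [∀ x, AddCommGroup (E x)] [∀ x, Module ℂ (E x)] [FiberBundle F E]
  [VectorBundle ℂ F E] [ContMDiffVectorBundle ω F E 𝓘(ℂ, V)]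

/-- The operator `d''` on the smooth sections of `H`, whose kernel is `E`. -/
noncomputable def dbar (s : Sec V F E) (x : M) : V →ₗ⋆[ℂ] E x := dbarAt (V := V) (F := F) s x

theorem Sec.mdiff_localRep (s : Sec V F E) (x : M) :
    MDifferentiableAt 𝓘(ℝ, V) 𝓘(ℝ, F) (localRep (F := F) x s) x :=
  ((contMDiffAt_iff_localRep x (mem_baseSet_trivializationAt F E x) s).1
    (s.contMDiff x)).mdifferentiableAt (by simp)

theorem diff_add' {G : Type*} [NormedAddCommGroup G] [NormedSpace ℝ G] {f g : M → G} {x : M}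
    (hf : MDifferentiableAt 𝓘(ℝ, V) 𝓘(ℝ, G) f x) (hg : MDifferentiableAt 𝓘(ℝ, V) 𝓘(ℝ, G) g x) :
    diff (V := V) (fun y => f y + g y) x = diff (V := V) f x + diff (V := V) g x := by
  have := mvfderiv_add hf hg
  refine LinearMap.ext fun v => ?_
  exact DFunLike.congr_fun this v

theorem diff_mul {f g : M → ℂ} {x : M}
    (hf : MDifferentiableAt 𝓘(ℝ, V) 𝓘(ℝ, ℂ) f x) (hg : MDifferentiableAt 𝓘(ℝ, V) 𝓘(ℝ, ℂ) g x) (v : V) :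
    diff (V := V) (fun y => f y * g y) x v = diff (V := V) f x v * g x + f x * diff (V := V) g x v :=
  mvfderiv_bilin (ContinuousLinearMap.mul ℝ ℂ) hf hg v

theorem dbar_add (s t : Sec V F E) (x : M) (v : V) :
    dbar (s + t) x v = dbar s x v + dbar t x v := by
  have hx := mem_baseSet_trivializationAt F E x
  have h : localRep (F := F) x (s + t : Sec V F E) =ᶠ[𝓝 x]
      fun y => localRep (F := F) x s y + localRep (F := F) x t y := by
    filter_upwards [(trivializationAt F E x).open_baseSet.mem_nhds hx] with y hy
    exact localRep_add x hy s t
  simp only [dbar, dbarAt, LinearMap.comp_apply]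
  rw [mvfderiv_congr h, diff_add' (s.mdiff_localRep x) (t.mdiff_localRep x), ← map_add]
  congr 1
  simp only [part01, LinearMap.coe_mk, AddHom.coe_mk, LinearMap.add_apply]
  module

theorem dbar_fsmul (f : M → ℂ) (hf : ContMDiff 𝓘(ℝ, V) 𝓘(ℝ, ℂ) ∞ f) (s : Sec V F E) (x : M) (v : V) :
    dbar (s.fsmul f hf) x v = f x • dbar s x v + delbar (V := V) f x v • s x := by
  have hx := mem_baseSet_trivializationAt F E x
  have h : localRep (F := F) x (s.fsmul f hf) =ᶠ[𝓝 x]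
      fun y => ContinuousLinearMap.lsmul ℝ ℂ (f y) (localRep (F := F) x s y) := by
    filter_upwards [(trivializationAt F E x).open_baseSet.mem_nhds hx] with y hy
    exact localRep_smul x hy f s
  have hd (w : V) : diff (V := V) (localRep (F := F) x (s.fsmul f hf)) x w =
      diff (V := V) f x w • localRep (F := F) x s x + f x • diff (V := V) (localRep (F := F) x s) x w := by
    rw [mvfderiv_congr h, mvfderiv_bilin _ ((hf x).mdifferentiableAt (by simp)) (s.mdiff_localRep x)]
    rfl
  have h01 : part01 (diff (V := V) (localRep (F := F) x (s.fsmul f hf)) x) v =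
      f x • part01 (diff (V := V) (localRep (F := F) x s) x) v +
        delbar (V := V) f x v • localRep (F := F) x s x := by
    simp only [delbar, part01, LinearMap.coe_mk, AddHom.coe_mk, hd, smul_eq_mul]
    module
  simp only [dbar, dbarAt, LinearMap.comp_apply]
  rw [h01, map_add, map_smul, map_smul, (trivializationAt F E x).symmₗ_apply hx (localRep x s x), symm_localRep x hx]

variable [IsManifold 𝓘(ℂ, V) ω M]

theorem del_smooth (f : M → ℂ) (hf : ContMDiff 𝓘(ℝ, V) 𝓘(ℝ, ℂ) ∞ f) (X : VF V M) :
    ContMDiff 𝓘(ℝ, V) 𝓘(ℝ, ℂ) ∞ (fun x => del (V := V) f x (X.val x)) := fun x => by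
  have h : ContDiff ℝ ∞ (fun p : ℂ × ℂ => (1 / 2 : ℂ) • (p.1 - Complex.I • p.2)) := by fun_prop
  exact h.contMDiff.contMDiffAt.comp x ((contMDiffAt_mvfderiv_apply (hf x) X).prodMk_space
    (contMDiffAt_mvfderiv_apply (hf x) X.J))

theorem dbar_smooth (s : Sec V F E) (X : VF V M) :
    ContMDiff 𝓘(ℝ, V) (𝓘(ℝ, V).prod 𝓘(ℝ, F)) ∞
      (fun x => TotalSpace.mk' F x (dbar s x (X.val x))) := fun x₀ => by
  have hx₀ := mem_baseSet_trivializationAt F E x₀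
  rw [contMDiffAt_iff_localRep x₀ hx₀]
  have hs := (contMDiffAt_iff_localRep x₀ hx₀ s).1 (s.contMDiff x₀)
  have h : ContDiff ℝ ∞ (fun p : F × F => (1 / 2 : ℂ) • (p.1 + Complex.I • p.2)) := by fun_prop
  refine (h.contMDiff.contMDiffAt.comp x₀ ((contMDiffAt_mvfderiv_apply hs X).prodMk_space
    (contMDiffAt_mvfderiv_apply hs X.J))).congr_of_eventuallyEq ?_
  filter_upwards [(trivializationAt F E x₀).open_baseSet.mem_nhds hx₀] with y hy
  simp only [dbar, localRep]
  rw [dbarAt_eq x₀ hy _ (s.contMDiff y), (trivializationAt F E x₀).symmₗ_apply hy,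
    (trivializationAt F E x₀).apply_mk_symm hy]
  rfl

variable (V F E) in
/-- Operators associating with a vector field an operator on the smooth sections of `H`. -/
abbrev Op := VF V M → Sec V F E → Sec V F E

variable (V F E) in
/-- The operator `X, s ↦ d''_X s`. -/
noncomputable def dbarOp : Op V F E := fun X s =>
  ⟨fun x => dbar s x (X.val x), dbar_smooth s X⟩

end Operators


section Data

variable (V : Type*) [NormedAddCommGroup V] [NormedSpace ℂ V]
  {M : Type*} [TopologicalSpace M] [ChartedSpace V M]
  (F : Type*) [NormedAddCommGroup F] [NormedSpace ℂ F]
  (E : M → Type*) [TopologicalSpace (TotalSpace F E)] [∀ x, TopologicalSpace (E x)]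
  [∀ x, AddCommGroup (E x)] [∀ x, Module ℂ (E x)] [FiberBundle F E]
  [VectorBundle ℂ F E] [ContMDiffVectorBundle ω F E 𝓘(ℂ, V)] [IsManifold 𝓘(ℂ, V) ω M]

/-- `C^∞` endomorphisms of `H`. -/
@[ext]
structure SmoothEnd where
  toFun : ∀ x, Module.End ℂ (E x)
  smooth : ∀ s : Sec V F E, ContMDiff 𝓘(ℝ, V) (𝓘(ℝ, V).prod 𝓘(ℝ, F)) ∞
    (fun x => TotalSpace.mk' F x (toFun x (s x)))

/-- `C^∞` forms of type `(1,0)` with values in the endomorphisms of `H`. -/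
@[ext]
structure Form10 where
  toFun : ∀ x, V →ₗ[ℂ] Module.End ℂ (E x)
  smooth : ∀ (X : VF V M) (s : Sec V F E), ContMDiff 𝓘(ℝ, V) (𝓘(ℝ, V).prod 𝓘(ℝ, F)) ∞
    (fun x => TotalSpace.mk' F x (toFun x (X.val x) (s x)))

/-- Connections of type `(1,0)` on `H`: for a section `s`, a point `x` and a tangent vector `v` at
`x`, the value is `∇_v s`. -/
@[ext]
structure Conn10 where
  toFun : Sec V F E → ∀ x, V →ₗ[ℂ] E x
  smooth : ∀ (X : VF V M) (s : Sec V F E), ContMDiff 𝓘(ℝ, V) (𝓘(ℝ, V).prod 𝓘(ℝ, F)) ∞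
    (fun x => TotalSpace.mk' F x (toFun s x (X.val x)))
  map_add : ∀ s t x v, toFun (s + t) x v = toFun s x v + toFun t x v
  leibniz : ∀ (f : M → ℂ) (hf : ContMDiff 𝓘(ℝ, V) 𝓘(ℝ, ℂ) ∞ f) (s : Sec V F E) (x : M) (v : V),
    toFun (s.fsmul f hf) x v = f x • toFun s x v + del (V := V) f x v • s x

/-- Nondegenerate Hermitian forms on `H` (not necessarily positive definite), linear in the first
variable and conjugate-linear in the second one. -/
@[ext]
structure HermForm where
  toFun : ∀ x, E x →ₗ[ℂ] E x →ₗ⋆[ℂ] ℂ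
  conj_symm : ∀ x u w, conj (toFun x u w) = toFun x w u
  nondeg : ∀ x u, (∀ w, toFun x u w = 0) → u = 0
  smooth : ∀ s t : Sec V F E, ContMDiff 𝓘(ℝ, V) 𝓘(ℝ, ℂ) ∞ (fun x => toFun x (s x) (t x))

/-- Nondegenerate symmetric `C^∞` bilinear forms on `H`. -/
@[ext]
structure SymForm where
  toFun : ∀ x, E x →ₗ[ℂ] E x →ₗ[ℂ] ℂ
  symm : ∀ x u w, toFun x u w = toFun x w u
  nondeg : ∀ x u, (∀ w, toFun x u w = 0) → u = 0
  smooth : ∀ s t : Sec V F E, ContMDiff 𝓘(ℝ, V) 𝓘(ℝ, ℂ) ∞ (fun x => toFun x (s x) (t x))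

/-- Antilinear `C^∞` involutions of `H`. -/
@[ext]
structure RealStructure where
  toFun : ∀ x, E x →ₗ⋆[ℂ] E x
  involutive : ∀ x u, toFun x (toFun x u) = u
  smooth : ∀ s : Sec V F E, ContMDiff 𝓘(ℝ, V) (𝓘(ℝ, V).prod 𝓘(ℝ, F)) ∞
    (fun x => TotalSpace.mk' F x (toFun x (s x)))

end Data

section Herm

variable {V : Type*} [NormedAddCommGroup V] [NormedSpace ℂ V]
  {M : Type*} [TopologicalSpace M] [ChartedSpace V M]
  {F : Type*} [NormedAddCommGroup F] [NormedSpace ℂ F]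
  {E : M → Type*} [TopologicalSpace (TotalSpace F E)] [∀ x, TopologicalSpace (E x)]
  [∀ x, AddCommGroup (E x)] [∀ x, Module ℂ (E x)] [FiberBundle F E]
  [VectorBundle ℂ F E] [ContMDiffVectorBundle ω F E 𝓘(ℂ, V)] [IsManifold 𝓘(ℂ, V) ω M]

theorem contDiff_det (n : ℕ) :
    ContDiff ℝ ∞ (fun A : Fin n → Fin n → ℂ => Matrix.det (Matrix.of A)) := by
  simp only [Matrix.det_apply]
  refine ContDiff.sum fun σ _ => ?_
  refine ContDiff.const_smul _ (contDiff_prod fun i _ => ?_)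
  exact (contDiff_apply_apply ℝ ℂ (σ i) i)

theorem contMDiffAt_det {n : ℕ} {N : M → Fin n → Fin n → ℂ} {x : M}
    (hN : ∀ i j, ContMDiffAt 𝓘(ℝ, V) 𝓘(ℝ, ℂ) ∞ (fun y => N y i j) x) :
    ContMDiffAt 𝓘(ℝ, V) 𝓘(ℝ, ℂ) ∞ (fun y => Matrix.det (Matrix.of (N y))) x := by
  have h : ContMDiffAt 𝓘(ℝ, V) 𝓘(ℝ, Fin n → Fin n → ℂ) ∞ N x :=
    contMDiffAt_pi_space.2 fun i => contMDiffAt_pi_space.2 fun j => hN i j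
  exact (contDiff_det n).contMDiff.contMDiffAt.comp x h

variable [FiniteDimensional ℂ V] [FiniteDimensional ℂ F] [T2Space M]

/-- A section is smooth as soon as its pairings with all smooth sections are smooth. -/
theorem HermForm.smooth_of_pair (h : HermForm V F E) (t : ∀ x, E x)
    (ht : ∀ s : Sec V F E, ContMDiff 𝓘(ℝ, V) 𝓘(ℝ, ℂ) ∞ (fun x => h.toFun x (t x) (s x))) :
    ContMDiff 𝓘(ℝ, V) (𝓘(ℝ, V).prod 𝓘(ℝ, F)) ∞ (fun x => TotalSpace.mk' F x (t x)) := fun x₀ => by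
  classical
  let e := trivializationAt F E x₀
  have hx₀ : x₀ ∈ e.baseSet := mem_baseSet_trivializationAt F E x₀
  let b := Module.finBasis ℂ F
  let ε (i : Fin (Module.finrank ℂ F)) : Sec V F E := frameSec V E x₀ (b i)
  let N : M → Fin (Module.finrank ℂ F) → Fin (Module.finrank ℂ F) → ℂ :=
    fun y i j => h.toFun y (ε i y) (ε j y)
  let g : M → Fin (Module.finrank ℂ F) → ℂ := fun y j => h.toFun y (t y) (ε j y)
  let τ : M → Fin (Module.finrank ℂ F) → ℂ := fun y i => b.coord i (localRep (F := F) x₀ t y)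
  have hN (i j) : ContMDiff 𝓘(ℝ, V) 𝓘(ℝ, ℂ) ∞ (fun y => N y i j) := h.smooth _ _
  have hg (j) : ContMDiff 𝓘(ℝ, V) 𝓘(ℝ, ℂ) ∞ (fun y => g y j) := ht _
  have hε : ∀ᶠ y in 𝓝 x₀, ∀ i, ε i y = e.symmₗ ℂ y (b i) :=
    Filter.eventually_all.2 fun i => frameSec_eventuallyEq x₀ (b i)
  have hexp (y : M) (hy : y ∈ e.baseSet) (hεy : ∀ i, ε i y = e.symmₗ ℂ y (b i)) (s : ∀ x, E x) :
      s y = ∑ i, b.coord i (localRep (F := F) x₀ s y) • ε i y := by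
    have h3 : s y = e.symmₗ ℂ y (∑ i, b.coord i (localRep (F := F) x₀ s y) • b i) := by
      simp only [Module.Basis.coord_apply, b.sum_repr]
      rw [e.symmₗ_apply hy, symm_localRep x₀ hy]
    conv_lhs => rw [h3]
    rw [map_sum]
    exact Finset.sum_congr rfl fun i _ => by rw [map_smul, hεy]
  have hdet (y : M) (hy : y ∈ e.baseSet) (hεy : ∀ i, ε i y = e.symmₗ ℂ y (b i)) :
      Matrix.det (Matrix.of (N y)) ≠ 0 := by
    intro h0
    obtain ⟨c, hc0, hc⟩ := Matrix.exists_vecMul_eq_zero_iff.2 h0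
    have hu : e.symmₗ ℂ y (∑ i, c i • b i) = ∑ i, c i • ε i y := by
      rw [map_sum]; exact Finset.sum_congr rfl fun i _ => by rw [map_smul, hεy]
    have hz : e.symmₗ ℂ y (∑ i, c i • b i) = 0 := by
      refine h.nondeg y _ fun w => ?_
      have hw := hexp y hy hεy (Function.update 0 y w)
      rw [Function.update_self] at hw
      rw [hw, hu, map_sum]
      refine Finset.sum_eq_zero fun j _ => ?_
      rw [LinearMap.map_smulₛₗ, map_sum, LinearMap.sum_apply]
      have := congr_fun hc j
      simp only [Matrix.vecMul, dotProduct, Matrix.of_apply, Pi.zero_apply] at this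
      simp only [map_smul, LinearMap.smul_apply]
      change _ • ∑ i, c i * N y i j = 0
      rw [this, smul_zero]
    have hz2 := e.linearMapAt_symmₗ (R := ℂ) hy (∑ i, c i • b i)
    rw [hz, map_zero] at hz2
    exact hc0 (funext fun i => (Fintype.linearIndependent_iff.1 b.linearIndependent) c hz2.symm i)
  have hdet0 : Matrix.det (Matrix.of (N x₀)) ≠ 0 := hdet x₀ hx₀ hε.self_of_nhds
  have hcr (y : M) (hy : y ∈ e.baseSet) (hεy : ∀ i, ε i y = e.symmₗ ℂ y (b i)) (i) :
      τ y i = (Matrix.det (Matrix.of (N y)))⁻¹ *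
        ∑ j, g y j * Matrix.adjugate (Matrix.of (N y)) j i := by
    have h1 : g y = Matrix.vecMul (τ y) (Matrix.of (N y)) := by
      funext j
      simp only [g]
      rw [hexp y hy hεy t, map_sum, LinearMap.sum_apply]
      simp only [map_smul, LinearMap.smul_apply, Matrix.vecMul, dotProduct, Matrix.of_apply]
      rfl
    have h2 : Matrix.vecMul (g y) (Matrix.adjugate (Matrix.of (N y))) =
        Matrix.det (Matrix.of (N y)) • τ y := by
      rw [h1, Matrix.vecMul_vecMul, Matrix.mul_adjugate, Matrix.vecMul_smul, Matrix.vecMul_one]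
    have h3 := congr_fun h2 i
    simp only [Matrix.vecMul, dotProduct, Pi.smul_apply, smul_eq_mul] at h3
    rw [h3, inv_mul_cancel_left₀ (hdet y hy hεy)]
  have hτ (i) : ContMDiffAt 𝓘(ℝ, V) 𝓘(ℝ, ℂ) ∞ (fun y => τ y i) x₀ := by
    have hd := contMDiffAt_det (fun i j => hN i j x₀)
    have hinv : ContMDiffAt 𝓘(ℝ, V) 𝓘(ℝ, ℂ) ∞ (fun y => (Matrix.det (Matrix.of (N y)))⁻¹) x₀ :=
      (contDiffAt_inv ℝ hdet0).contMDiffAt.comp x₀ hd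
    have hadj (j) : ContMDiffAt 𝓘(ℝ, V) 𝓘(ℝ, ℂ) ∞
        (fun y => Matrix.adjugate (Matrix.of (N y)) j i) x₀ := by
      simp only [Matrix.adjugate_apply]
      refine contMDiffAt_det (N := fun y => (Matrix.of (N y)).updateRow i (Pi.single j 1)) ?_
      intro k l
      by_cases hk : k = i
      · subst hk
        simp only [Matrix.updateRow_self]
        exact contMDiffAt_const
      · simp only [Matrix.updateRow_ne hk]
        exact hN k l x₀
    have hsum : ∀ T : Finset (Fin (Module.finrank ℂ F)), ContMDiffAt 𝓘(ℝ, V) 𝓘(ℝ, ℂ) ∞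
        (fun y => ∑ j ∈ T, g y j * Matrix.adjugate (Matrix.of (N y)) j i) x₀ := by
      intro T
      induction T using Finset.induction_on with
      | empty => simpa using contMDiffAt_const
      | insert j T hj ih =>
        simp only [Finset.sum_insert hj]
        exact (contMDiff_cmul (hg j x₀) (hadj j)).add ih
    refine (contMDiff_cmul hinv (hsum Finset.univ)).congr_of_eventuallyEq ?_
    filter_upwards [hε, e.open_baseSet.mem_nhds hx₀] with y hy1 hy2
    exact hcr y hy2 hy1 i
  rw [contMDiffAt_iff_localRep x₀ hx₀]
  have hl : ContDiff ℝ ∞ (fun c : Fin (Module.finrank ℂ F) → ℂ => ∑ i, c i • b i) := by fun_prop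
  refine (hl.contMDiff.contMDiffAt.comp x₀ (contMDiffAt_pi_space.2 hτ)).congr_of_eventuallyEq ?_
  refine Filter.Eventually.of_forall fun y => ?_
  simp only [Function.comp, τ, Module.Basis.coord_apply, b.sum_repr]


theorem fibre_finiteDimensional (F : Type*) [NormedAddCommGroup F] [NormedSpace ℂ F]
    [FiniteDimensional ℂ F] (E : M → Type*) [TopologicalSpace (TotalSpace F E)]
    [∀ x, TopologicalSpace (E x)] [∀ x, AddCommGroup (E x)] [∀ x, Module ℂ (E x)] [FiberBundle F E]
    [VectorBundle ℂ F E] (x : M) : FiniteDimensional ℂ (E x) :=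
  Module.Finite.equiv ((trivializationAt F E x).linearEquivAt ℂ x
    (mem_baseSet_trivializationAt F E x)).symm

theorem HermForm.exists_riesz (h : HermForm V F E) (x : M) (L : E x →ₗ[ℂ] ℂ) :
    ∃ w, ∀ u, h.toFun x u w = L u := by
  have := fibre_finiteDimensional F E x
  let b := Module.finBasis ℂ (E x)
  let T : E x →ₗ[ℂ] (Fin (Module.finrank ℂ (E x)) → ℂ) :=
    LinearMap.pi fun i => (h.toFun x).flip (b i)
  have hT : Function.Injective T := by
    rw [injective_iff_map_eq_zero]
    intro w hw
    refine h.nondeg x w fun u => ?_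
    rw [← b.sum_repr u, map_sum]
    refine Finset.sum_eq_zero fun i _ => ?_
    rw [LinearMap.map_smulₛₗ, show h.toFun x w (b i) = 0 from congr_fun hw i, smul_zero]
  have hS := (LinearMap.injective_iff_surjective_of_finrank_eq_finrank (f := T) (by simp)).1 hT
  obtain ⟨w, hw⟩ := hS fun i => conj (L (b i))
  refine ⟨w, fun u => ?_⟩
  rw [← b.sum_repr u, map_sum, map_sum, LinearMap.sum_apply]
  refine Finset.sum_congr rfl fun i _ => ?_
  rw [map_smul, map_smul, LinearMap.smul_apply, ← h.conj_symm,
    show h.toFun x w (b i) = conj (L (b i)) from congr_fun hw i, Complex.conj_conj]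

/-- The vector representing a linear form with respect to `h`. -/
noncomputable def HermForm.riesz (h : HermForm V F E) (x : M) (L : E x →ₗ[ℂ] ℂ) : E x :=
  (h.exists_riesz x L).choose

theorem HermForm.apply_riesz (h : HermForm V F E) (x : M) (L : E x →ₗ[ℂ] ℂ) (u : E x) :
    h.toFun x u (h.riesz x L) = L u := (h.exists_riesz x L).choose_spec u

theorem HermForm.ext_right (h : HermForm V F E) {x : M} {w w' : E x}
    (hw : ∀ u, h.toFun x u w = h.toFun x u w') : w = w' := by
  rw [← sub_eq_zero]
  refine h.nondeg x _ fun u => ?_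
  rw [← h.conj_symm, map_sub, hw, sub_self, map_zero]

/-- The adjoint with respect to `h` of an endomorphism of the fibre at `x`. -/
noncomputable def HermForm.adjAt (h : HermForm V F E) (x : M) (P : Module.End ℂ (E x)) :
    Module.End ℂ (E x) where
  toFun w := h.riesz x (((h.toFun x).flip w).comp P)
  map_add' w w' := h.ext_right fun u => by simp [h.apply_riesz]
  map_smul' c w := h.ext_right fun u => by simp [h.apply_riesz]

theorem HermForm.apply_adjAt (h : HermForm V F E) (x : M) (P : Module.End ℂ (E x)) (u w : E x) :
    h.toFun x u (h.adjAt x P w) = h.toFun x (P u) w := h.apply_riesz x _ u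

theorem contMDiff_conj {f : M → ℂ} (hf : ContMDiff 𝓘(ℝ, V) 𝓘(ℝ, ℂ) ∞ f) :
    ContMDiff 𝓘(ℝ, V) 𝓘(ℝ, ℂ) ∞ (fun x => conj (f x)) :=
  Complex.conjCLE.contDiff.contMDiff.comp hf

/-- The action of an endomorphism on sections. -/
noncomputable def SmoothEnd.act (A : SmoothEnd V F E) (s : Sec V F E) : Sec V F E :=
  ⟨fun x => A.toFun x (s x), A.smooth s⟩

/-- The adjoint `A^†` of a `C^∞` endomorphism with respect to `h`. -/
noncomputable def HermForm.adj (h : HermForm V F E) (A : SmoothEnd V F E) : SmoothEnd V F E where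
  toFun x := h.adjAt x (A.toFun x)
  smooth s := by
    refine h.smooth_of_pair _ fun t => ?_
    have h1 := contMDiff_conj (h.smooth (A.act t) s)
    refine h1.congr fun x => ?_
    rw [← h.conj_symm, h.apply_adjAt]
    rfl

/-- The endomorphism `Φ_X` associated with a vector field `X`. -/
noncomputable def Form10.at (Φ : Form10 V F E) (X : VF V M) : SmoothEnd V F E :=
  ⟨fun x => Φ.toFun x (X.val x), Φ.smooth X⟩

/-- The operator `X, s ↦ Φ_X s`. -/
noncomputable def Form10.op (Φ : Form10 V F E) : Op V F E := fun X s => (Φ.at X).act s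

/-- The operator `X, s ↦ Φ^†_X s`, where `Φ^†` is the adjoint of `Φ` with respect to `h`; it is
the `(0,1)`-form given by `(Φ^†)_v = (Φ_v)^†`. -/
noncomputable def HermForm.adjOp (h : HermForm V F E) (Φ : Form10 V F E) : Op V F E :=
  fun X s => (h.adj (Φ.at X)).act s

/-- The operator `X, s ↦ ∇_X s`. -/
noncomputable def Conn10.op (nabla : Conn10 V F E) : Op V F E :=
  fun X s => ⟨fun x => nabla.toFun s x (X.val x), nabla.smooth X s⟩

/-- The connection `D' + d''` is the Chern connection of `h` if it is compatible with `h`: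
`d (h(s,t)) = h(Ds,t) + h(s,Dt)`. -/
noncomputable def HermForm.IsChern (h : HermForm V F E) (D' : Conn10 V F E) : Prop :=
  ∀ (s t : Sec V F E) (x : M) (v : V),
    diff (V := V) (fun y => h.toFun y (s y) (t y)) x v =
      h.toFun x (D'.toFun s x v + dbar s x v) (t x) + h.toFun x (s x) (D'.toFun t x v + dbar t x v)

theorem del_mul {f g : M → ℂ} (hf : ContMDiff 𝓘(ℝ, V) 𝓘(ℝ, ℂ) ∞ f)
    (hg : ContMDiff 𝓘(ℝ, V) 𝓘(ℝ, ℂ) ∞ g) (x : M) (v : V) :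
    del (V := V) (fun y => f y * g y) x v = del (V := V) f x v * g x + f x * del (V := V) g x v := by
  have h (w : V) := diff_mul ((hf x).mdifferentiableAt (by simp)) ((hg x).mdifferentiableAt (by simp)) w
  simp only [del, part10, LinearMap.coe_mk, AddHom.coe_mk, h, smul_eq_mul]
  ring

theorem del_add {f g : M → ℂ} (hf : ContMDiff 𝓘(ℝ, V) 𝓘(ℝ, ℂ) ∞ f)
    (hg : ContMDiff 𝓘(ℝ, V) 𝓘(ℝ, ℂ) ∞ g) (x : M) (v : V) :
    del (V := V) (fun y => f y + g y) x v = del (V := V) f x v + del (V := V) g x v := by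
  have h := diff_add' ((hf x).mdifferentiableAt (by simp)) ((hg x).mdifferentiableAt (by simp))
  simp only [del, part10, LinearMap.coe_mk, AddHom.coe_mk, h, LinearMap.add_apply, smul_eq_mul]
  ring

theorem del_conj {f : M → ℂ} (hf : ContMDiff 𝓘(ℝ, V) 𝓘(ℝ, ℂ) ∞ f) (x : M) (v : V) :
    del (V := V) (fun y => conj (f y)) x v = conj (delbar (V := V) f x v) := by
  have h (w : V) : diff (V := V) (fun y => conj (f y)) x w = conj (diff (V := V) f x w) := by
    have hf' := (hf x).mdifferentiableAt (n := ∞) (by simp)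
    have h3 : MDifferentiableAt 𝓘(ℝ, V) 𝓘(ℝ, ℂ) (fun y => conj (f y)) x :=
      (contMDiff_conj hf x).mdifferentiableAt (by simp)
    rw [mvfderiv_eq_fderiv h3, mvfderiv_eq_fderiv hf']
    have h4 := (mdiff_chart hf').hasFDerivAt
    have h5 := (Complex.conjCLE : ℂ →L[ℝ] ℂ).hasFDerivAt.comp _ h4
    have h6 := h5.fderiv
    have h7 : ((fun y => conj (f y)) ∘ (chartAt V x).symm) =
      ((Complex.conjCLE : ℂ →L[ℝ] ℂ) ∘ f ∘ (chartAt V x).symm) := rfl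
    rw [h7, h6]
    rfl
  simp only [del, delbar, part10, part01, LinearMap.coe_mk, AddHom.coe_mk, h, smul_eq_mul, map_mul,
    map_add, Complex.conj_I, map_div₀, map_one, map_ofNat]
  ring


theorem delbar_conj {f : M → ℂ} (hf : ContMDiff 𝓘(ℝ, V) 𝓘(ℝ, ℂ) ∞ f) (x : M) (v : V) :
    delbar (V := V) (fun y => conj (f y)) x v = conj (del (V := V) f x v) := by
  have h := del_conj (contMDiff_conj hf) x v
  simp only [Complex.conj_conj] at h
  rw [h, Complex.conj_conj]

/-- The expression `∂(h(s,t))(v) - h(s, d''_v t)`. -/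
noncomputable def HermForm.defect (h : HermForm V F E) (s t : Sec V F E) (x : M) (v : V) : ℂ :=
  del (V := V) (fun y => h.toFun y (s y) (t y)) x v - h.toFun x (s x) (dbar t x v)

theorem HermForm.defect_add_right (h : HermForm V F E) (s t t' : Sec V F E) (x : M) (v : V) :
    h.defect s (t + t') x v = h.defect s t x v + h.defect s t' x v := by
  have h1 : (fun y => h.toFun y (s y) ((t + t' : Sec V F E) y)) =
      fun y => h.toFun y (s y) (t y) + h.toFun y (s y) (t' y) := by
    funext y; exact map_add _ _ _
  simp only [HermForm.defect]
  rw [h1, del_add (h.smooth s t) (h.smooth s t'), dbar_add, map_add]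
  ring

theorem HermForm.defect_fsmul_right (h : HermForm V F E) (s t : Sec V F E) (f : M → ℂ)
    (hf : ContMDiff 𝓘(ℝ, V) 𝓘(ℝ, ℂ) ∞ f) (x : M) (v : V) :
    h.defect s (t.fsmul f hf) x v = conj (f x) * h.defect s t x v := by
  have h1 : (fun y => h.toFun y (s y) (t.fsmul f hf y)) =
      fun y => conj (f y) * h.toFun y (s y) (t y) := by
    funext y; simp
  simp only [HermForm.defect]
  rw [h1, del_mul (contMDiff_conj hf) (h.smooth s t), dbar_fsmul, map_add, del_conj hf]
  simp only [LinearMap.map_smulₛₗ, smul_eq_mul]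
  ring

theorem HermForm.defect_add_left (h : HermForm V F E) (s s' t : Sec V F E) (x : M) (v : V) :
    h.defect (s + s') t x v = h.defect s t x v + h.defect s' t x v := by
  have h1 : (fun y => h.toFun y ((s + s' : Sec V F E) y) (t y)) =
      fun y => h.toFun y (s y) (t y) + h.toFun y (s' y) (t y) := by
    funext y
    rw [ContMDiffSection.coe_add, Pi.add_apply, map_add, LinearMap.add_apply]
  simp only [HermForm.defect]
  rw [h1, del_add (h.smooth s t) (h.smooth s' t), ContMDiffSection.coe_add, Pi.add_apply, map_add,
    LinearMap.add_apply]
  ring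

theorem HermForm.defect_fsmul_left (h : HermForm V F E) (s t : Sec V F E) (f : M → ℂ)
    (hf : ContMDiff 𝓘(ℝ, V) 𝓘(ℝ, ℂ) ∞ f) (x : M) (v : V) :
    h.defect (s.fsmul f hf) t x v =
      f x * h.defect s t x v + del (V := V) f x v * h.toFun x (s x) (t x) := by
  have h1 : (fun y => h.toFun y (s.fsmul f hf y) (t y)) =
      fun y => f y * h.toFun y (s y) (t y) := by
    funext y; simp
  simp only [HermForm.defect]
  rw [h1, del_mul hf (h.smooth s t), Sec.fsmul_apply, map_smul, LinearMap.smul_apply, smul_eq_mul]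
  ring

theorem HermForm.defect_congr (h : HermForm V F E) (s : Sec V F E) {t t' : Sec V F E} {x : M}
    (ht : t x = t' x) (v : V) : h.defect s t x v = h.defect s t' x v := by
  have h0 := Sec.vanish_induction (fun t => h.defect s t x v = 0) x
    (fun a b ha hb => by simp only [h.defect_add_right, ha, hb, add_zero])
    (fun f hf a h0 => by simp only [h.defect_fsmul_right, h0, map_zero, zero_mul])
    (t - t') (by rw [ContMDiffSection.coe_sub, Pi.sub_apply, ht, sub_self])
  have h1 := h.defect_add_right s (t - t') t' x v
  rw [sub_add_cancel, h0, zero_add] at h1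
  exact h1

theorem HermForm.ext_left (h : HermForm V F E) {x : M} {w w' : E x}
    (hw : ∀ u, h.toFun x w u = h.toFun x w' u) : w = w' :=
  h.ext_right fun u => by rw [← h.conj_symm, hw, h.conj_symm]

/-- The value `D'_v s` of the Chern connection. -/
noncomputable def HermForm.chernAt (h : HermForm V F E) (s : Sec V F E) (x : M) (v : V) : E x :=
  h.riesz x
    { toFun := fun u => conj (h.defect s (extSec V F u) x v)
      map_add' := fun u w => by rw [extSec_add, h.defect_add_right, map_add]
      map_smul' := fun c u => by
        rw [extSec_smul, h.defect_fsmul_right, map_mul, Complex.conj_conj]; rfl }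

theorem HermForm.chernAt_apply (h : HermForm V F E) (s t : Sec V F E) (x : M) (v : V) :
    h.toFun x (h.chernAt s x v) (t x) = h.defect s t x v := by
  rw [← h.conj_symm, HermForm.chernAt, h.apply_riesz]
  change conj (conj _) = _
  rw [Complex.conj_conj]
  exact h.defect_congr s (extSec_apply_self _) v

theorem HermForm.chernAt_apply' (h : HermForm V F E) (s : Sec V F E) (x : M) (v : V) (u : E x) :
    h.toFun x (h.chernAt s x v) u = h.defect s (extSec V F u) x v := by
  rw [← h.chernAt_apply, extSec_apply_self]

theorem HermForm.chernAt_add_vec (h : HermForm V F E) (s : Sec V F E) (x : M) (v w : V) :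
    h.chernAt s x (v + w) = h.chernAt s x v + h.chernAt s x w := by
  refine h.ext_left fun u => ?_
  rw [map_add, LinearMap.add_apply]
  simp only [h.chernAt_apply', HermForm.defect, map_add]
  ring

theorem HermForm.chernAt_smul_vec (h : HermForm V F E) (s : Sec V F E) (x : M) (c : ℂ) (v : V) :
    h.chernAt s x (c • v) = c • h.chernAt s x v := by
  refine h.ext_left fun u => ?_
  rw [map_smul, LinearMap.smul_apply]
  simp only [h.chernAt_apply', HermForm.defect, map_smul, LinearMap.map_smulₛₗ, smul_eq_mul,
    Complex.conj_conj]
  ring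

theorem HermForm.chernAt_add (h : HermForm V F E) (s t : Sec V F E) (x : M) (v : V) :
    h.chernAt (s + t) x v = h.chernAt s x v + h.chernAt t x v := by
  refine h.ext_left fun u => ?_
  rw [map_add, LinearMap.add_apply, h.chernAt_apply', h.chernAt_apply', h.chernAt_apply',
    h.defect_add_left]

theorem HermForm.chernAt_fsmul (h : HermForm V F E) (f : M → ℂ)
    (hf : ContMDiff 𝓘(ℝ, V) 𝓘(ℝ, ℂ) ∞ f) (s : Sec V F E) (x : M) (v : V) :
    h.chernAt (s.fsmul f hf) x v = f x • h.chernAt s x v + del (V := V) f x v • s x := by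
  refine h.ext_left fun u => ?_
  rw [map_add, LinearMap.add_apply, map_smul, map_smul, LinearMap.smul_apply,
    LinearMap.smul_apply, h.chernAt_apply', h.chernAt_apply', h.defect_fsmul_left,
    extSec_apply_self]
  rfl

/-- The `(1,0)`-part `D'` of the Chern connection `D = D' + d''` of `h`; it is characterized by
`HermForm.chern_spec` and `HermForm.IsChern.unique`. -/
noncomputable def HermForm.chern (h : HermForm V F E) : Conn10 V F E where
  toFun s x := 
    { toFun := h.chernAt s x
      map_add' := h.chernAt_add_vec s x
      map_smul' := h.chernAt_smul_vec s x }
  smooth X s := h.smooth_of_pair _ fun t =>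
    ((del_smooth _ (h.smooth s t) X).sub (h.smooth s (dbarOp V F E X t))).congr fun x =>
      h.chernAt_apply s t x _
  map_add := h.chernAt_add
  leibniz := h.chernAt_fsmul

theorem HermForm.chern_spec (h : HermForm V F E) : h.IsChern h.chern := by
  intro s t x v
  change _ = h.toFun x (h.chernAt s x v + dbar s x v) (t x) +
    h.toFun x (s x) (h.chernAt t x v + dbar t x v)
  have h1 : del (V := V) (fun y => h.toFun y (s y) (t y)) x v =
      h.toFun x (h.chernAt s x v) (t x) + h.toFun x (s x) (dbar t x v) := by
    rw [h.chernAt_apply, HermForm.defect]; ring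
  have h2 : delbar (V := V) (fun y => h.toFun y (s y) (t y)) x v =
      h.toFun x (dbar s x v) (t x) + h.toFun x (s x) (h.chernAt t x v) := by
    have h3 : del (V := V) (fun y => h.toFun y (t y) (s y)) x v =
        h.toFun x (h.chernAt t x v) (s x) + h.toFun x (t x) (dbar s x v) := by
      rw [h.chernAt_apply, HermForm.defect]; ring
    have h4 : (fun y => h.toFun y (s y) (t y)) = fun y => conj (h.toFun y (t y) (s y)) := by
      funext y; rw [h.conj_symm]
    rw [h4, delbar_conj (h.smooth t s), h3, map_add, h.conj_symm, h.conj_symm, add_comm]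
  rw [← part10_add_part01 (diff (V := V) (fun y => h.toFun y (s y) (t y)) x) v]
  change del (V := V) (fun y => h.toFun y (s y) (t y)) x v +
    delbar (V := V) (fun y => h.toFun y (s y) (t y)) x v = _
  rw [h1, h2, map_add, map_add, LinearMap.add_apply]
  ring

theorem HermForm.IsChern.unique {h : HermForm V F E} {D₁ D₂ : Conn10 V F E} (h₁ : h.IsChern D₁)
    (h₂ : h.IsChern D₂) : D₁ = D₂ := by
  refine Conn10.ext (funext fun s => funext fun x => LinearMap.ext fun v => h.ext_left fun u => ?_)
  have key (v : V) : h.toFun x (D₁.toFun s x v) u + h.toFun x (s x) (D₁.toFun (extSec V F u) x v) =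
      h.toFun x (D₂.toFun s x v) u + h.toFun x (s x) (D₂.toFun (extSec V F u) x v) := by
    have := (h₁ s (extSec V F u) x v).symm.trans (h₂ s (extSec V F u) x v)
    simp only [extSec_apply_self, map_add, LinearMap.add_apply] at this
    linear_combination this
  have k1 := key v
  have k2 := key (Complex.I • v)
  simp only [map_smul, LinearMap.smul_apply, LinearMap.map_smulₛₗ, smul_eq_mul,
    Complex.conj_I] at k2
  linear_combination (1 / 2 : ℂ) * k1 - (1 / 2 * Complex.I) * k2 + (1 / 2 : ℂ) *
    (h.toFun x (D₁.toFun s x v) u - h.toFun x (D₂.toFun s x v) u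
      - h.toFun x (s x) (D₁.toFun (extSec V F u) x v)
      + h.toFun x (s x) (D₂.toFun (extSec V F u) x v)) * Complex.I_sq

end Herm

section Structures

variable {V : Type*} [NormedAddCommGroup V] [NormedSpace ℂ V]
  {M : Type*} [TopologicalSpace M] [ChartedSpace V M]
  {F : Type*} [NormedAddCommGroup F] [NormedSpace ℂ F]
  {E : M → Type*} [TopologicalSpace (TotalSpace F E)] [∀ x, TopologicalSpace (E x)]
  [∀ x, AddCommGroup (E x)] [∀ x, Module ℂ (E x)] [FiberBundle F E]
  [VectorBundle ℂ F E] [ContMDiffVectorBundle ω F E 𝓘(ℂ, V)] [IsManifold 𝓘(ℂ, V) ω M]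

/-! ### Endomorphisms, endomorphism-valued forms and connections -/

noncomputable instance : Add (SmoothEnd V F E) where
  add A B := ⟨fun x => A.toFun x + B.toFun x, fun s => (A.act s + B.act s).contMDiff⟩

noncomputable instance : Sub (SmoothEnd V F E) where
  sub A B := ⟨fun x => A.toFun x - B.toFun x, fun s => (A.act s - B.act s).contMDiff⟩

/-- The commutator `[A, B] = A B - B A`. -/
noncomputable instance : Bracket (SmoothEnd V F E) (SmoothEnd V F E) where
  bracket A B := ⟨fun x => A.toFun x * B.toFun x - B.toFun x * A.toFun x,
    fun s => (A.act (B.act s) - B.act (A.act s)).contMDiff⟩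

/-- The commutator `[A, Φ]_v = A Φ_v - Φ_v A`. -/
noncomputable instance : Bracket (SmoothEnd V F E) (Form10 V F E) where
  bracket A Φ :=
    { toFun := fun x =>
        { toFun := fun v => A.toFun x * Φ.toFun x v - Φ.toFun x v * A.toFun x
          map_add' := fun v w => by rw [map_add, mul_add, add_mul]; abel
          map_smul' := fun c v => by
            rw [map_smul, mul_smul_comm, smul_mul_assoc, RingHom.id_apply, smul_sub] }
      smooth := fun X s => (A.act (Φ.op X s) - Φ.op X (A.act s)).contMDiff }

noncomputable instance : HAdd (Conn10 V F E) (Form10 V F E) (Conn10 V F E) where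
  hAdd nabla Φ :=
    { toFun := fun s x => nabla.toFun s x + (Φ.toFun x).flip (s x)
      smooth := fun X s => (nabla.op X s + Φ.op X s).contMDiff
      map_add := fun s t x v => by
        simp only [LinearMap.add_apply, LinearMap.flip_apply, nabla.map_add,
          ContMDiffSection.coe_add, Pi.add_apply, map_add]
        abel
      leibniz := fun f hf s x v => by
        simp only [LinearMap.add_apply, LinearMap.flip_apply, nabla.leibniz, Sec.fsmul_apply,
          map_smul, smul_add]
        abel }

noncomputable instance : HSub (Conn10 V F E) (Form10 V F E) (Conn10 V F E) where
  hSub nabla Φ :=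
    { toFun := fun s x => nabla.toFun s x - (Φ.toFun x).flip (s x)
      smooth := fun X s => (nabla.op X s - Φ.op X s).contMDiff
      map_add := fun s t x v => by
        simp only [LinearMap.sub_apply, LinearMap.flip_apply, nabla.map_add,
          ContMDiffSection.coe_add, Pi.add_apply, map_add, LinearMap.add_apply]
        abel
      leibniz := fun f hf s x v => by
        simp only [LinearMap.sub_apply, LinearMap.flip_apply, nabla.leibniz, Sec.fsmul_apply,
          map_smul, smul_sub]
        abel }

/-- The operator `X, s ↦ (d''A)_X s = d''_X (A s) - A (d''_X s)`. -/
noncomputable def SmoothEnd.dbarEnd (A : SmoothEnd V F E) : Op V F E :=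
  fun X s => dbarOp V F E X (A.act s) - A.act (dbarOp V F E X s)

/-- `A` is a holomorphic endomorphism: `d''(A) = 0`. -/
noncomputable def SmoothEnd.IsHolomorphic (A : SmoothEnd V F E) : Prop := ∀ X s, A.dbarEnd X s = 0

section dEnd

variable [FiniteDimensional ℂ V] [FiniteDimensional ℂ F] [T2Space M]

theorem Conn10.dEnd_congr (nabla : Conn10 V F E) (A : SmoothEnd V F E) {s t : Sec V F E} {x : M}
    (hst : s x = t x) (v : V) :
    nabla.toFun (A.act s) x v - A.toFun x (nabla.toFun s x v) =
      nabla.toFun (A.act t) x v - A.toFun x (nabla.toFun t x v) := by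
  have hact (a b : Sec V F E) : A.act (a + b) = A.act a + A.act b := by
    ext y
    exact _root_.map_add (A.toFun y) _ _
  have hact' (f : M → ℂ) (hf : ContMDiff 𝓘(ℝ, V) 𝓘(ℝ, ℂ) ∞ f) (a : Sec V F E) :
      A.act (a.fsmul f hf) = (A.act a).fsmul f hf := by
    ext y
    exact map_smul (A.toFun y) _ _
  have h0 := Sec.vanish_induction
    (fun s => nabla.toFun (A.act s) x v - A.toFun x (nabla.toFun s x v) = 0) x
    (fun a b ha hb => by
      rw [hact, nabla.map_add, nabla.map_add, _root_.map_add, add_sub_add_comm, ha, hb, add_zero])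
    (fun f hf a h0 => by
      rw [hact', nabla.leibniz, nabla.leibniz, _root_.map_add, map_smul, map_smul, h0, zero_smul,
        zero_smul, zero_add, zero_add]
      exact sub_self _)
    (s - t) (by rw [ContMDiffSection.coe_sub, Pi.sub_apply, hst, sub_self])
  have h1 : s = (s - t) + t := (sub_add_cancel s t).symm
  rw [h1, hact, nabla.map_add, nabla.map_add, _root_.map_add, add_sub_add_comm, h0, zero_add]

/-- The `(1,0)`-form `∇(A)`, given by `∇(A)_v s = ∇_v (A s) - A (∇_v s)`; see
`Conn10.dEnd_apply`. -/
noncomputable def Conn10.dEnd (nabla : Conn10 V F E) (A : SmoothEnd V F E) : Form10 V F E where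
  toFun x := 
    { toFun := fun v =>
        { toFun := fun u =>
            nabla.toFun (A.act (extSec V F u)) x v - A.toFun x (nabla.toFun (extSec V F u) x v)
          map_add' := fun u w => by
            rw [nabla.dEnd_congr A (t := extSec V F u + extSec V F w)
              (by rw [extSec_add])]
            have hact : A.act (extSec V F u + extSec V F w) =
                A.act (extSec V F u) + A.act (extSec V F w) := by
              ext y
              exact _root_.map_add (A.toFun y) _ _
            rw [hact, nabla.map_add, nabla.map_add, _root_.map_add, add_sub_add_comm]
          map_smul' := fun c u => by
            have hact : A.act ((extSec V F u).fsmul (fun _ => c) contMDiff_const) =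
                (A.act (extSec V F u)).fsmul (fun _ => c) contMDiff_const := by
              ext y
              exact map_smul (A.toFun y) _ _
            rw [extSec_smul, hact, nabla.leibniz, nabla.leibniz, _root_.map_add, map_smul, map_smul,
              RingHom.id_apply, smul_sub]
            exact add_sub_add_right_eq_sub _ _ _ }
      map_add' := fun v w => LinearMap.ext fun u => by
        simp only [LinearMap.coe_mk, AddHom.coe_mk, LinearMap.add_apply, _root_.map_add]
        abel
      map_smul' := fun c v => LinearMap.ext fun u => by
        simp only [LinearMap.coe_mk, AddHom.coe_mk, LinearMap.smul_apply, map_smul,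
          RingHom.id_apply, smul_sub] }
  smooth X s := (nabla.op X (A.act s) - A.act (nabla.op X s)).contMDiff.congr fun x =>
    congrArg (TotalSpace.mk' F x) (nabla.dEnd_congr A (extSec_apply_self (s x)) (X.val x))

theorem Conn10.dEnd_apply (nabla : Conn10 V F E) (A : SmoothEnd V F E) (s : Sec V F E) (x : M)
    (v : V) : (nabla.dEnd A).toFun x v (s x) =
      nabla.toFun (A.act s) x v - A.toFun x (nabla.toFun s x v) :=
  nabla.dEnd_congr A (extSec_apply_self (s x)) v

end dEnd

/-! ### Equations between forms of degree two -/

/-- Near `x₀`, `X` is the vector field with constant value `v` in the preferred (holomorphic)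
chart at `x₀`. -/
noncomputable def IsCoordField (x₀ : M) (v : V) (X : VF V M) : Prop :=
  ∀ᶠ y in 𝓝 x₀, mfderiv 𝓘(ℝ, V) 𝓘(ℝ, V) (chartAt V x₀) y (X y) = v

/-- Every tangent vector is the value of a vector field which is constant in a chart. -/
theorem exists_coordField [FiniteDimensional ℂ V] [T2Space M] (x₀ : M) (v : V) :
    ∃ X : VF V M, IsCoordField x₀ v X := by
  let e := trivializationAt V (TangentSpace 𝓘(ℝ, V) : M → Type _) x₀
  have hx₀ : x₀ ∈ e.baseSet := mem_baseSet_trivializationAt V _ x₀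
  obtain ⟨χ, hχ, hs, h1⟩ := exists_cutoff (V := V) x₀ (e.open_baseSet.mem_nhds hx₀)
  refine ⟨⟨fun x => χ x • e.symm x v, ?_⟩, ?_⟩
  · refine ContMDiffOn.smul_section_of_tsupport hχ.contMDiffOn e.open_baseSet hs fun x hx => ?_
    refine ContMDiffAt.contMDiffWithinAt ?_
    refine (e.contMDiffAt_section_iff hx).2 ?_
    refine (contMDiffAt_const (c := v)).congr_of_eventuallyEq ?_
    filter_upwards [e.open_baseSet.mem_nhds hx] with y hy
    exact congrArg Prod.snd (e.apply_mk_symm hy v)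
  · filter_upwards [h1, e.open_baseSet.mem_nhds hx₀] with y hy hye
    have hsrc : y ∈ (chartAt V x₀).source := by
      simpa [e, TangentBundle.trivializationAt_baseSet] using hye
    have h2 := TangentBundle.continuousLinearMapAt_trivializationAt (𝕜 := ℝ) (I := 𝓘(ℝ, V)) hsrc
    have h3 : mfderiv 𝓘(ℝ, V) 𝓘(ℝ, V) (chartAt V x₀) y =
      mfderiv 𝓘(ℝ, V) 𝓘(ℝ, V) (extChartAt 𝓘(ℝ, V) x₀) y := by simp [mfld_simps]
    change mfderiv 𝓘(ℝ, V) 𝓘(ℝ, V) (chartAt V x₀) y (χ y • e.symm y v) = v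
    rw [hy, h3, ← h2]
    change e.continuousLinearMapAt ℝ y ((1 : ℝ) • e.symm y v) = v
    rw [one_smul, e.continuousLinearMapAt_apply ℝ, e.coe_linearMapAt_of_mem (R := ℝ) hye]
    exact congrArg Prod.snd (e.apply_mk_symm hye v)

/-- The operators `P_X` and `Q_Y` commute at every point `x₀` for all vector fields `X` and `Y`
which are constant in the chart at `x₀`. As the `(1,0)`- and `(0,1)`-parts of such vector fields
commute with each other, this expresses the vanishing of the `2`-form `P Q + Q P`
(of `P ^ 2` when `P = Q`). -/
noncomputable def CoordCommute (P Q : Op V F E) : Prop :=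
  ∀ (x₀ : M) (v w : V) (X Y : VF V M), IsCoordField x₀ v X → IsCoordField x₀ w Y →
    ∀ s : Sec V F E, P X (Q Y s) x₀ = Q Y (P X s) x₀

/-- `∇² = 0`. -/
noncomputable def Conn10.IsFlat (nabla : Conn10 V F E) : Prop := CoordCommute nabla.op nabla.op

/-- `d''∇ + ∇d'' = 0`. -/
noncomputable def Conn10.IsHolomorphic (nabla : Conn10 V F E) : Prop := CoordCommute (dbarOp V F E) nabla.op

/-- `d''(Φ) = 0`. -/
noncomputable def Form10.IsHolomorphic (Φ : Form10 V F E) : Prop := CoordCommute (dbarOp V F E) Φ.op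

/-- `Φ ∧ Φ = 0`. -/
noncomputable def Form10.WedgeSelfZero (Φ : Form10 V F E) : Prop :=
  ∀ x v w, Φ.toFun x v * Φ.toFun x w = Φ.toFun x w * Φ.toFun x v

/-- `∇(Φ) = 0`. -/
noncomputable def Conn10.FormParallel (nabla : Conn10 V F E) (Φ : Form10 V F E) : Prop :=
  ∀ (x₀ : M) (v w : V) (X Y : VF V M), IsCoordField x₀ v X → IsCoordField x₀ w Y →
    ∀ s : Sec V F E,
      (nabla.op X (Φ.op Y s) - Φ.op Y (nabla.op X s)) x₀ =
        (nabla.op Y (Φ.op X s) - Φ.op X (nabla.op Y s)) x₀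

/-- `[A, Φ] = 0`. -/
noncomputable def Form10.CommutesWith (Φ : Form10 V F E) (A : SmoothEnd V F E) : Prop :=
  ∀ x v, A.toFun x * Φ.toFun x v = Φ.toFun x v * A.toFun x

/-! ### Symmetric bilinear forms -/

/-- The form `g` is holomorphic: `d''(g) = 0`. -/
noncomputable def SymForm.IsHolomorphic (g : SymForm V F E) : Prop :=
  ∀ (s t : Sec V F E) (x : M) (v : V), delbar (V := V) (fun y => g.toFun y (s y) (t y)) x v =
    g.toFun x (dbar s x v) (t x) + g.toFun x (s x) (dbar t x v)

/-- `∇(g) = 0`. -/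
noncomputable def SymForm.IsParallel (g : SymForm V F E) (nabla : Conn10 V F E) : Prop :=
  ∀ (s t : Sec V F E) (x : M) (v : V), del (V := V) (fun y => g.toFun y (s y) (t y)) x v =
    g.toFun x (nabla.toFun s x v) (t x) + g.toFun x (s x) (nabla.toFun t x v)

/-- `A^* = A`, where `A^*` is the adjoint with respect to `g`. -/
noncomputable def SymForm.SelfAdj (g : SymForm V F E) (A : SmoothEnd V F E) : Prop :=
  ∀ x u w, g.toFun x (A.toFun x u) w = g.toFun x u (A.toFun x w)

/-- `A^* = -A`, where `A^*` is the adjoint with respect to `g`. -/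
noncomputable def SymForm.SkewAdj (g : SymForm V F E) (A : SmoothEnd V F E) : Prop :=
  ∀ x u w, g.toFun x (A.toFun x u) w = -g.toFun x u (A.toFun x w)

/-- `Φ^* = Φ`, where `Φ^*` is the adjoint with respect to `g`. -/
noncomputable def SymForm.FormSelfAdj (g : SymForm V F E) (Φ : Form10 V F E) : Prop :=
  ∀ x v u w, g.toFun x (Φ.toFun x v u) w = g.toFun x u (Φ.toFun x v w)

/-! ### Real structures -/

/-- The action of `κ` on sections. -/
noncomputable def RealStructure.act (κ : RealStructure V F E) (s : Sec V F E) : Sec V F E :=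
  ⟨fun x => κ.toFun x (s x), κ.smooth s⟩

/-- `h(κ u, κ w)` is the complex conjugate of `h(u, w)`. -/
noncomputable def HermForm.IsReal (h : HermForm V F E) (κ : RealStructure V F E) : Prop :=
  ∀ x u w, h.toFun x (κ.toFun x u) (κ.toFun x w) = conj (h.toFun x u w)

/-- The bilinear form `g(u, w) = h(u, κ w)`. -/
noncomputable def HermForm.bilin (h : HermForm V F E) (κ : RealStructure V F E) (hκ : h.IsReal κ) :
    SymForm V F E where
  toFun x :=
    { toFun := fun u => (h.toFun x u).comp (κ.toFun x)
      map_add' := fun u w => by ext; simp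
      map_smul' := fun c u => by ext; simp }
  symm x u w := by
    change h.toFun x u (κ.toFun x w) = h.toFun x w (κ.toFun x u)
    have h1 := hκ x (κ.toFun x u) w
    rw [κ.involutive, h.conj_symm] at h1
    exact h1
  nondeg x u hu := h.nondeg x u fun w => by
    have h1 : h.toFun x u (κ.toFun x (κ.toFun x w)) = 0 := hu (κ.toFun x w)
    rwa [κ.involutive] at h1
  smooth s t := h.smooth s (κ.act t)

/-- The form `g` is real on the vectors fixed by `κ`. -/
noncomputable def SymForm.IsReal (g : SymForm V F E) (κ : RealStructure V F E) : Prop :=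
  ∀ x u w, κ.toFun x u = u → κ.toFun x w = w → conj (g.toFun x u w) = g.toFun x u w

theorem SymForm.IsReal.conj_apply {g : SymForm V F E} {κ : RealStructure V F E} (hg : g.IsReal κ)
    (x : M) (u w : E x) :
    conj (g.toFun x u w) = g.toFun x (κ.toFun x u) (κ.toFun x w) := by
  have hI := Complex.I_sq
  have f1 (u : E x) : κ.toFun x (u + κ.toFun x u) = u + κ.toFun x u := by
    rw [map_add, κ.involutive, add_comm]
  have f2 (u : E x) : κ.toFun x (Complex.I • (u - κ.toFun x u)) = Complex.I • (u - κ.toFun x u) := by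
    rw [LinearMap.map_smulₛₗ, map_sub, κ.involutive, Complex.conj_I]
    module
  have e1 := hg x _ _ (f1 u) (f1 w)
  have e2 := hg x _ _ (f1 u) (f2 w)
  have e3 := hg x _ _ (f2 u) (f1 w)
  have e4 := hg x _ _ (f2 u) (f2 w)
  simp only [map_add, map_sub, map_smul, LinearMap.add_apply, LinearMap.sub_apply,
    LinearMap.smul_apply, smul_eq_mul, map_mul, Complex.conj_I] at e1 e2 e3 e4
  generalize g.toFun x u w = a at *
  generalize g.toFun x u (κ.toFun x w) = b at *
  generalize g.toFun x (κ.toFun x u) w = c at *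
  generalize g.toFun x (κ.toFun x u) (κ.toFun x w) = d at *
  have e2' : -(conj a - conj b + (conj c - conj d)) = a - b + (c - d) := by
    linear_combination (-Complex.I) * e2 + (-(a - b + (c - d)) -(conj a - conj b + (conj c - conj d)) ) * hI
  have e3' : -(conj a + conj b - (conj c + conj d)) = a + b - (c + d) := by
    linear_combination (-Complex.I) * e3 + (-(a + b - (c + d)) -(conj a + conj b - (conj c + conj d)) ) * hI
  have e4' : conj a - conj b - (conj c - conj d) = a - b - (c - d) := by
    linear_combination -e4 - (a - b - (c - d) - (conj a - conj b - (conj c - conj d))) * hI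
  linear_combination (1 / 4 : ℂ) * e1 - (1 / 4 : ℂ) * e2' - (1 / 4 : ℂ) * e3' + (1 / 4 : ℂ) * e4'

/-- The Hermitian form `h` such that `h(u, κ w) = g(u, w)`. -/
noncomputable def SymForm.herm (g : SymForm V F E) (κ : RealStructure V F E) (hg : g.IsReal κ) :
    HermForm V F E where
  toFun x :=
    { toFun := fun u => (g.toFun x u).comp (κ.toFun x)
      map_add' := fun u w => by ext; simp
      map_smul' := fun c u => by ext; simp }
  conj_symm x u w := by
    change conj (g.toFun x u (κ.toFun x w)) = g.toFun x w (κ.toFun x u)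
    rw [hg.conj_apply, κ.involutive, g.symm]
  nondeg x u hu := g.nondeg x u fun w => by
    have h1 : g.toFun x u (κ.toFun x (κ.toFun x w)) = 0 := hu (κ.toFun x w)
    rwa [κ.involutive] at h1
  smooth s t := g.smooth s (κ.act t)

/-! ### Harmonic Higgs bundles -/

variable [FiniteDimensional ℂ V] [FiniteDimensional ℂ F] [T2Space M]

/-- The connection `D' + d'' + Φ + Φ^†` associated with `h` and `Φ`, where `D = D' + d''` is the
Chern connection of `h`. -/
noncomputable def HermForm.higgsOp (h : HermForm V F E) (Φ : Form10 V F E) : Op V F E :=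
  fun X s => h.chern.op X s + dbarOp V F E X s + Φ.op X s + h.adjOp Φ X s

/-- `(E, h, Φ)` is a harmonic Higgs bundle: `Φ` is a holomorphic Higgs field and the connection
`D + Φ + Φ^†` is integrable. -/
structure IsHarmonicHiggs (h : HermForm V F E) (Φ : Form10 V F E) : Prop where
  holomorphic : Φ.IsHolomorphic
  wedge : Φ.WedgeSelfZero
  flat : CoordCommute (h.higgsOp Φ) (h.higgsOp Φ)

/-! ### Saito structures -/

variable (V F E) in
/-- Saito structures (of weight `0`) on `E`. -/
@[ext]
structure SaitoStructure where
  nabla : Conn10 V F E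
  g : SymForm V F E
  Φ : Form10 V F E
  calU : SmoothEnd V F E
  calV : SmoothEnd V F E
  nabla_holomorphic : nabla.IsHolomorphic
  g_holomorphic : g.IsHolomorphic
  Φ_holomorphic : Φ.IsHolomorphic
  calU_holomorphic : calU.IsHolomorphic
  calV_holomorphic : calV.IsHolomorphic
  flat : nabla.IsFlat
  nabla_calV : ∀ x v, (nabla.dEnd calV).toFun x v = 0
  wedge : Φ.WedgeSelfZero
  calU_comm : Φ.CommutesWith calU
  nabla_Φ : nabla.FormParallel Φ
  /-- `∇(U) - [Φ, V] + Φ = 0` -/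
  nabla_calU : ∀ x v, (nabla.dEnd calU).toFun x v -
    (Φ.toFun x v * calV.toFun x - calV.toFun x * Φ.toFun x v) + Φ.toFun x v = 0
  nabla_g : g.IsParallel nabla
  calV_adj : g.SkewAdj calV
  Φ_adj : g.FormSelfAdj Φ
  calU_adj : g.SelfAdj calU

variable (V F E) in
/-- Harmonic potential real Saito structures on `E`. Here `Adag` is the endomorphism `A^†`. -/
structure HarmonicPotentialRealSaito extends SaitoStructure V F E where
  /- The real structure. -/
  κ : RealStructure V F E
  g_real : g.IsReal κ
  /-- `D'(g) = 0`, where `D'` comes from the Chern connection of `h`. -/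
  chern_g : g.IsParallel (g.herm κ g_real).chern
  harmonic : IsHarmonicHiggs (g.herm κ g_real) Φ
  /- The potential; `Adag.dbarEnd` is `Φ^† = d''A^†` and `nabla - ⁅Adag, Φ⁆` is `D'`. -/
  Adag : SmoothEnd V F E
  Adag_adj : g.SelfAdj Adag
  Dprime_flat : (nabla - ⁅Adag, Φ⁆ : Conn10 V F E).IsFlat
  Dprime_Φdag : CoordCommute (nabla - ⁅Adag, Φ⁆ : Conn10 V F E).op Adag.dbarEnd
  wedge_Φdag : CoordCommute Adag.dbarEnd Adag.dbarEnd
  /- The compatibility conditions. -/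
  chern_eq : (g.herm κ g_real).chern = nabla - ⁅Adag, Φ⁆
  Φ_dag : (g.herm κ g_real).adjOp Φ = Adag.dbarEnd
  calQ_dag : (g.herm κ g_real).adj (calV + ⁅Adag, calU⁆) = calV + ⁅Adag, calU⁆

namespace HarmonicPotentialRealSaito

variable (S : HarmonicPotentialRealSaito V F E)

/-- The Hermitian form `h` defined by `h(u, κ w) = g(u, w)`. -/
noncomputable def h : HermForm V F E := S.g.herm S.κ S.g_real

/-- `Q = V + [A^†, U]`. -/
noncomputable def calQ : SmoothEnd V F E := S.calV + ⁅S.Adag, S.calU⁆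

/-- The endomorphism `A`, which is the adjoint of `A^†` with respect to `h`. -/
noncomputable def A : SmoothEnd V F E := S.h.adj S.Adag

end HarmonicPotentialRealSaito

/-! ### Potential tt* bundles -/

variable (V F E) in
/-- Potential tt* bundles with underlying holomorphic bundle `E`. The Higgs field `Φ = D'A` is
written `h.chern.dEnd A`. -/
@[ext]
structure PotentialTTStar where
  h : HermForm V F E
  A : SmoothEnd V F E
  κ : RealStructure V F E
  calU : SmoothEnd V F E
  calQ : SmoothEnd V F E
  h_real : h.IsReal κ
  /-- `D(κ) = 0` -/
  D_κ : ∀ (s : Sec V F E) (x : M) (v : V),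
    h.chern.toFun (κ.act s) x v + dbar (κ.act s) x v =
      κ.toFun x (h.chern.toFun s x v + dbar s x v)
  harmonic : IsHarmonicHiggs h (h.chern.dEnd A)
  A_adj : (h.bilin κ h_real).SelfAdj A
  calU_holomorphic : calU.IsHolomorphic
  calQ_dag : h.adj calQ = calQ
  calU_comm : (h.chern.dEnd A).CommutesWith calU
  /-- `D'(U) - [Φ, Q] + Φ = 0` -/
  D_calU : ∀ x v, (h.chern.dEnd calU).toFun x v -
    ((h.chern.dEnd A).toFun x v * calQ.toFun x - calQ.toFun x * (h.chern.dEnd A).toFun x v) +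
      (h.chern.dEnd A).toFun x v = 0
  /-- `D'(Q) + [Φ, U^†] = 0` -/
  D_calQ : ∀ x v, (h.chern.dEnd calQ).toFun x v +
    ((h.chern.dEnd A).toFun x v * (h.adj calU).toFun x -
      (h.adj calU).toFun x * (h.chern.dEnd A).toFun x v) = 0
  calU_adj : (h.bilin κ h_real).SelfAdj calU
  calQ_adj : (h.bilin κ h_real).SkewAdj calQ

namespace PotentialTTStar

variable (T : PotentialTTStar V F E)

/-- The bilinear form `g(u, w) = h(u, κ w)`. -/
noncomputable def g : SymForm V F E := T.h.bilin T.κ T.h_real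

/-- The Higgs field `Φ = D'A`. -/
noncomputable def Φ : Form10 V F E := T.h.chern.dEnd T.A

/-- The endomorphism `A^†`. -/
noncomputable def Adag : SmoothEnd V F E := T.h.adj T.A

/-- The associated connection `∇ = D' + [A^†, Φ]`. -/
noncomputable def nabla : Conn10 V F E := T.h.chern + ⁅T.Adag, T.Φ⁆

/-- `V = Q - [A^†, U]`. -/
noncomputable def calV : SmoothEnd V F E := T.calQ - ⁅T.Adag, T.calU⁆

end PotentialTTStar

end Structures

end TTStar

/-! The two assignments are inverse to each other for formal reasons: `κ² = id` makes `g` and `h`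
determine each other, `A` and `A^†` are exchanged by the `h`-adjoint, and `D' = ∇ - [A^†, Φ]`, `Q =
V + [A^†, U]` can be solved for `∇` and `V`. The substance is that the axioms on one side give those
on the other.

The main tool is duality with respect to `h`. Since `∂ h(s, t) = h(D's, t) + h(s, d''t)`, each
identity for `d''` has an adjoint identity for `D'`. Thus `Φ^† = d''A^†` is the same as `Φ = D'A`
(`HermForm.adjOp_eq_iff`). When `Q^† = Q`, the equation `D'(Q) + [Φ, U^†] = 0` is the same as `d''Q
= [Φ^†, U]` (`HermForm.dEnd_add_comm_eq_zero_iff`); as `d''U = 0` and `Φ^† = d''A^†`, this says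
`d''V = 0`. In the same way `d''² = 0`, `d''Φ = 0` and `Φ ∧ Φ = 0` give `D'² = 0`, `D'(Φ^†) = 0` and
`Φ^† ∧ Φ^† = 0`, so the integrability conditions on `D'_A` and `Ψ` hold automatically for a
potential `tt*` bundle.

The flatness of `D + Φ + Φ^†` is used through its parts of type `(2,0)` and `(1,1)`. The first gives
`D'(Φ) = 0`, hence `∇(Φ) = 0`, because `[A^†, Φ]` contributes nothing when `Φ ∧ Φ = 0`. The second
gives `d''D' + D'd'' = -(Φ Φ^† + Φ^† Φ)`, which `d''[A^†, Φ]` cancels exactly; hence `∇` is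
holomorphic.

The rest is algebra. Compatibility of `h` with `D` translates `D(κ) = 0` into `D(g) = 0`; the Jacobi
identity with `[Φ, U] = 0` exchanges the two equations for `U`; brackets of `g`-selfadjoint
endomorphisms are `g`-skew. Only `∇² = 0` and `∇(V) = 0` are not obtained in this way, which is why
they are imposed on the `tt*` side.

Equations between 2-forms are tested on fields that are constant in a chart, so that no Lie bracket
terms appear. -/

namespace TTStar

set_option linter.unusedSectionVars false

/-! ### Vector fields constant in a chart, and symmetry of second derivatives along them. -/

section CoordinateFields

variable {V : Type*} [NormedAddCommGroup V] [NormedSpace ℂ V]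
  {M : Type*} [TopologicalSpace M] [ChartedSpace V M] [IsManifold 𝓘(ℂ, V) ω M]

@[simp] theorem VF.J_val (X : VF V M) (x : M) : X.J.val x = Complex.I • X.val x := rfl

theorem mdifferentiableAt_chartAt {x₀ y : M} (hy : y ∈ (chartAt V x₀).source) :
    MDifferentiableAt 𝓘(ℝ, V) 𝓘(ℝ, V) (chartAt V x₀) y :=
  (contMDiffAt_of_mem_maximalAtlas (n := ∞) (IsManifold.chart_mem_maximalAtlas x₀)
    hy).mdifferentiableAt (by simp)

theorem eventually_mem_source (x₀ : M) : ∀ᶠ y in 𝓝 x₀, y ∈ (chartAt V x₀).source :=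
  (chartAt V x₀).open_source.mem_nhds (mem_chart_source V x₀)

theorem IsCoordField.diff_chart {x₀ : M} {v : V} {X : VF V M} (hX : IsCoordField x₀ v X) :
    ∀ᶠ y in 𝓝 x₀, diff (V := V) (chartAt V x₀) y (X.val y) = v := hX

/-- If `X` is constant in the chart at `x₀`, then so is `i X`. -/
theorem IsCoordField.J {x₀ : M} {v : V} {X : VF V M} (hX : IsCoordField x₀ v X) :
    IsCoordField x₀ (Complex.I • v) X.J := by
  filter_upwards [hX.diff_chart, eventually_mem_source (V := V) x₀] with y hy hys
  -- The chart is holomorphic, so its differential commutes with multiplication by `i`.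
  have h : MDifferentiableAt 𝓘(ℂ, V) 𝓘(ℂ, V) (chartAt V x₀) y :=
    (contMDiffAt_of_mem_maximalAtlas (n := ω) (IsManifold.chart_mem_maximalAtlas x₀)
      hys).mdifferentiableAt (by simp)
  exact (mvfderiv_complexLinear h (X.val y)).trans (by rw [hy])

/-- The differential of a function at a point of a chart, in terms of the function read in that
chart. -/
theorem diff_eq_fderiv_chart {G : Type*} [NormedAddCommGroup G] [NormedSpace ℝ G] {f : M → G}
    {x₀ y : M} (hy : y ∈ (chartAt V x₀).source) (hf : MDifferentiableAt 𝓘(ℝ, V) 𝓘(ℝ, G) f y)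
    (u : V) :
    diff (V := V) f y u = fderiv ℝ (f ∘ (chartAt V x₀).symm) (chartAt V x₀ y)
      (diff (V := V) (chartAt V x₀) y u) := by
  set φ := chartAt V x₀
  have hy' : φ y ∈ φ.target := φ.map_source hy
  have hsymm : MDifferentiableAt 𝓘(ℝ, V) 𝓘(ℝ, V) φ.symm (φ y) :=
    (contMDiffAt_symm_of_mem_maximalAtlas (n := ∞) (IsManifold.chart_mem_maximalAtlas x₀)
      hy').mdifferentiableAt (by simp)
  have hg : MDifferentiableAt 𝓘(ℝ, V) 𝓘(ℝ, G) (f ∘ φ.symm) (φ y) :=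
    MDifferentiableAt.comp (I' := 𝓘(ℝ, V)) (φ y) (by rwa [φ.left_inv hy]) hsymm
  -- Factoring `f` through the chart near `y` turns the claim into the chain rule.
  have hev : f =ᶠ[𝓝 y] (f ∘ φ.symm) ∘ φ := by
    filter_upwards [φ.open_source.mem_nhds hy] with z hz
    simp [φ.left_inv hz]
  have h := mfderiv_comp (I := 𝓘(ℝ, V)) y hg (mdifferentiableAt_chartAt hy)
  rw [mvfderiv_congr hev]
  change mfderiv 𝓘(ℝ, V) 𝓘(ℝ, G) ((f ∘ φ.symm) ∘ φ) y u = _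
  rw [h, ← mfderiv_eq_fderiv]
  rfl

/-- The identification of `T_{x₀} M` with `V` is the one given by the preferred chart at `x₀`, so
the differential of that chart at its own centre is the identity. -/
theorem IsCoordField.val_eq {x₀ : M} {v : V} {X : VF V M} (hX : IsCoordField x₀ v X) :
    X.val x₀ = v := by
  rw [← hX.diff_chart.self_of_nhds, mvfderiv_eq_fderiv
    (mdifferentiableAt_chartAt (mem_chart_source V x₀))]
  have hev : chartAt V x₀ ∘ (chartAt V x₀).symm =ᶠ[𝓝 (chartAt V x₀ x₀)] id := by
    filter_upwards [(chartAt V x₀).open_target.mem_nhds (mem_chart_target V x₀)] with z hz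
    exact (chartAt V x₀).right_inv hz
  rw [hev.fderiv_eq, fderiv_id]
  rfl

/-- Every tangent vector is the value of a vector field. -/
theorem exists_vf_val [FiniteDimensional ℂ V] [T2Space M] (x : M) (v : V) :
    ∃ X : VF V M, X.val x = v :=
  let ⟨X, hX⟩ := exists_coordField x v
  ⟨X, hX.val_eq⟩

/-- Symmetry of second derivatives along vector fields which are constant in a chart. -/
theorem diff_diff_comm {G : Type*} [NormedAddCommGroup G] [NormedSpace ℂ G] {f : M → G}
    {x₀ : M} (hf : ContMDiffAt 𝓘(ℝ, V) 𝓘(ℝ, G) ∞ f x₀) {v w : V} {X Y : VF V M}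
    (hX : IsCoordField x₀ v X) (hY : IsCoordField x₀ w Y) :
    diff (V := V) (fun y => diff (V := V) f y (Y.val y)) x₀ (X.val x₀) =
      diff (V := V) (fun y => diff (V := V) f y (X.val y)) x₀ (Y.val x₀) := by
  set φ := chartAt V x₀
  have hx₀ : x₀ ∈ φ.source := mem_chart_source V x₀
  have hφ : ContDiffAt ℝ ∞ (f ∘ φ.symm) (φ x₀) := by
    have h2 : ContMDiffAt 𝓘(ℝ, V) 𝓘(ℝ, V) ∞ φ.symm (φ x₀) :=
      contMDiffAt_symm_of_mem_maximalAtlas (IsManifold.chart_mem_maximalAtlas x₀)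
        (φ.map_source hx₀)
    exact (ContMDiffAt.comp (I' := 𝓘(ℝ, V)) (φ x₀) (by rwa [φ.left_inv hx₀]) h2).contDiffAt
  -- Differentiability is needed at all nearby points. Smoothness at a point spreads to a
  -- neighbourhood for each finite order, and order `1` is enough.
  have hfd : ∀ᶠ y in 𝓝 x₀, MDifferentiableAt 𝓘(ℝ, V) 𝓘(ℝ, G) f y := by
    have h1 : ContMDiffAt 𝓘(ℝ, V) 𝓘(ℝ, G) 1 f x₀ := hf.of_le (by simp)
    filter_upwards [contMDiffAt_iff_contMDiffAt_nhds (by simp) |>.1 h1] with y hy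
    exact hy.mdifferentiableAt (by simp)
  -- Read in the chart, `Y` is the constant `w`, so differentiating `Y f` produces no term with a
  -- derivative of `Y`: only the second derivative of the coordinate expression remains, and it is
  -- symmetric.
  have key {v w : V} {X Y : VF V M} (hX : IsCoordField x₀ v X) (hY : IsCoordField x₀ w Y) :
      diff (V := V) (fun y => diff (V := V) f y (Y.val y)) x₀ (X.val x₀) =
        fderiv ℝ (fderiv ℝ (f ∘ φ.symm)) (φ x₀) v w := by
    have h2 : DifferentiableAt ℝ (fderiv ℝ (f ∘ φ.symm)) (φ x₀) :=
      (hφ.fderiv_right (m := 1) (WithTop.coe_le_coe.2 le_top)).differentiableAt (by simp)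
    have h3 : HasFDerivAt (fun z => fderiv ℝ (f ∘ φ.symm) z w)
        ((fderiv ℝ (fderiv ℝ (f ∘ φ.symm)) (φ x₀)).flip w) (φ x₀) := by
      simpa using h2.hasFDerivAt.clm_apply (hasFDerivAt_const w (φ x₀))
    have hsm := (contMDiffAt_mvfderiv_apply hf Y).mdifferentiableAt (by simp)
    have hev : (fun y => diff (V := V) f y (Y.val y)) ∘ φ.symm =ᶠ[𝓝 (φ x₀)]
        fun z => fderiv ℝ (f ∘ φ.symm) z w := by
      have ht : φ.symm (φ x₀) = x₀ := φ.left_inv hx₀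
      have hc : Filter.Tendsto φ.symm (𝓝 (φ x₀)) (𝓝 x₀) := by
        have := (φ.continuousAt_symm (φ.map_source hx₀)).tendsto
        rwa [ht] at this
      filter_upwards [hc.eventually hfd, hc.eventually hY.diff_chart,
        hc.eventually (eventually_mem_source (V := V) x₀),
        φ.open_target.mem_nhds (φ.map_source hx₀)] with z h1 h2 h3 h4
      change diff (V := V) f (φ.symm z) (Y.val (φ.symm z)) = _
      rw [diff_eq_fderiv_chart h3 h1, h2, φ.right_inv h4]
    rw [mvfderiv_eq_fderiv hsm, hev.fderiv_eq, h3.fderiv, hX.val_eq]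
    rfl
  have h2 : (2 : WithTop ℕ∞) ≤ ∞ := WithTop.coe_le_coe.2 le_top
  rw [key hX hY, key hY hX]
  exact (hφ.isSymmSndFDerivAt (by simpa using h2)) v w

end CoordinateFields

/-! ### Symmetry of second derivatives of type `(2,0)` and `(0,2)`. -/

section SecondDerivatives

variable {V : Type*} [NormedAddCommGroup V] [NormedSpace ℂ V]
  {M : Type*} [TopologicalSpace M] [ChartedSpace V M] [IsManifold 𝓘(ℂ, V) ω M]
  {G : Type*} [NormedAddCommGroup G] [NormedSpace ℂ G]

theorem diff_const_smul {f : M → G} {x : M} (hf : MDifferentiableAt 𝓘(ℝ, V) 𝓘(ℝ, G) f x) (c : ℂ)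
    (v : V) : diff (V := V) (fun y => c • f y) x v = c • diff (V := V) f x v := by
  have hc : MDifferentiableAt 𝓘(ℝ, V) 𝓘(ℝ, ℂ) (fun _ : M => c) x := mdifferentiableAt_const
  have h := mvfderiv_bilin (ContinuousLinearMap.lsmul ℝ ℂ) hc hf v
  have h0 : diff (V := V) (fun _ : M => c) x v = 0 := by
    change mfderiv 𝓘(ℝ, V) 𝓘(ℝ, ℂ) (fun _ : M => c) x v = 0
    rw [mfderiv_const]
    rfl
  rw [h0, map_zero, zero_apply, zero_add] at h
  exact h

/-- Symmetry of the second derivatives `½ (∂_X + c ∂_{iX})`. -/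
theorem half_diff_comm {f : M → G} {x₀ : M} (hf : ContMDiffAt 𝓘(ℝ, V) 𝓘(ℝ, G) ∞ f x₀)
    {v w : V} {X Y : VF V M} (hX : IsCoordField x₀ v X) (hY : IsCoordField x₀ w Y) (c : ℂ) :
    let D : VF V M → M → G := fun Z y =>
      (1 / 2 : ℂ) • (diff (V := V) f y (Z.val y) + c • diff (V := V) f y (Z.J.val y))
    (1 / 2 : ℂ) • (diff (V := V) (D Y) x₀ (X.val x₀) + c • diff (V := V) (D Y) x₀ (X.J.val x₀)) =
    (1 / 2 : ℂ) • (diff (V := V) (D X) x₀ (Y.val x₀) +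
      c • diff (V := V) (D X) x₀ (Y.J.val x₀)) := by
  intro D
  have hs (Z : VF V M) :
      MDifferentiableAt 𝓘(ℝ, V) 𝓘(ℝ, G) (fun y => diff (V := V) f y (Z.val y)) x₀ :=
    (contMDiffAt_mvfderiv_apply hf Z).mdifferentiableAt (by simp)
  have hsmul {k : M → G} (hk : MDifferentiableAt 𝓘(ℝ, V) 𝓘(ℝ, G) k x₀) (a : ℂ) :
      MDifferentiableAt 𝓘(ℝ, V) 𝓘(ℝ, G) (fun y => a • k y) x₀ :=
    ((ContinuousLinearMap.lsmul ℝ ℂ a : G →L[ℝ] G).differentiableAt).comp_mdifferentiableAt hk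
  have hD (Z : VF V M) (u : V) : diff (V := V) (D Z) x₀ u =
      (1 / 2 : ℂ) • (diff (V := V) (fun y => diff (V := V) f y (Z.val y)) x₀ u +
        c • diff (V := V) (fun y => diff (V := V) f y (Z.J.val y)) x₀ u) := by
    simp only [D]
    rw [diff_const_smul (f := fun y => diff (V := V) f y (Z.val y) +
      c • diff (V := V) f y (Z.J.val y)) ((hs Z).add (hsmul (hs Z.J) c)), diff_add' (hs Z) (hsmul (hs Z.J) c),
      LinearMap.add_apply, diff_const_smul (hs Z.J)]
  simp only [hD]
  -- Multiplication by `i` preserves fields constant in the chart, so each of the four real second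
  -- derivatives in the expansion is symmetric.
  rw [diff_diff_comm hf hX hY, diff_diff_comm hf hX.J hY, diff_diff_comm hf hX hY.J,
    diff_diff_comm hf hX.J hY.J]
  module

/-- The case `c = i` of `half_diff_comm`: this is `∂̄² = 0` for vector-valued functions. -/
theorem part01_diff_comm {f : M → G} {x₀ : M} (hf : ContMDiffAt 𝓘(ℝ, V) 𝓘(ℝ, G) ∞ f x₀)
    {v w : V} {X Y : VF V M} (hX : IsCoordField x₀ v X) (hY : IsCoordField x₀ w Y) :
    part01 (diff (V := V) (fun y => part01 (diff (V := V) f y) (Y.val y)) x₀) (X.val x₀) =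
      part01 (diff (V := V) (fun y => part01 (diff (V := V) f y) (X.val y)) x₀) (Y.val x₀) :=
  half_diff_comm hf hX hY Complex.I

/-- The case `c = -i` of `half_diff_comm`, that is, `∂² = 0`; it is applied to `h(s, t)` to prove
`D'² = 0`. -/
theorem del_del_comm {f : M → ℂ} {x₀ : M} (hf : ContMDiffAt 𝓘(ℝ, V) 𝓘(ℝ, ℂ) ∞ f x₀)
    {v w : V} {X Y : VF V M} (hX : IsCoordField x₀ v X) (hY : IsCoordField x₀ w Y) :
    del (V := V) (fun y => del (V := V) f y (Y.val y)) x₀ (X.val x₀) =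
      del (V := V) (fun y => del (V := V) f y (X.val y)) x₀ (Y.val x₀) := by
  have h := half_diff_comm hf hX hY (-Complex.I)
  simp only [neg_smul, ← sub_eq_add_neg] at h
  exact h

end SecondDerivatives

/-! ### `d''² = 0`, pointwise formulas, and separation of operators by type. -/

section Calculus

variable {V : Type*} [NormedAddCommGroup V] [NormedSpace ℂ V]
  {M : Type*} [TopologicalSpace M] [ChartedSpace V M]
  {F : Type*} [NormedAddCommGroup F] [NormedSpace ℂ F]
  {E : M → Type*} [TopologicalSpace (TotalSpace F E)] [∀ x, TopologicalSpace (E x)]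
  [∀ x, AddCommGroup (E x)] [∀ x, Module ℂ (E x)] [FiberBundle F E]
  [VectorBundle ℂ F E] [ContMDiffVectorBundle ω F E 𝓘(ℂ, V)] [IsManifold 𝓘(ℂ, V) ω M]

/-- `d''² = 0`. -/
theorem dbarOp_comm : CoordCommute (dbarOp V F E) (dbarOp V F E) := by
  intro x₀ v w X Y hX hY s
  have hx₀ := mem_baseSet_trivializationAt F E x₀
  have hs := (contMDiffAt_iff_localRep x₀ hx₀ s).1 (s.contMDiff x₀)
  -- By definition `d''` at `y` uses the trivialization centred at `y`. As `dbarAt_eq` allows one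
  -- fixed trivialization near `x₀`, both applications of `d''` become `∂̄` of an `F`-valued
  -- function.
  have hrep (Z : VF V M) : localRep (F := F) x₀ (dbarOp V F E Z s) =ᶠ[𝓝 x₀]
      fun y => part01 (diff (V := V) (localRep (F := F) x₀ s) y) (Z.val y) := by
    filter_upwards [(trivializationAt F E x₀).open_baseSet.mem_nhds hx₀] with y hy
    change localRep (F := F) x₀ (fun y => dbarAt (V := V) (F := F) s y (Z.val y)) y = _
    simp only [localRep]
    rw [dbarAt_eq x₀ hy _ (s.contMDiff y), (trivializationAt F E x₀).symmₗ_apply hy,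
      (trivializationAt F E x₀).apply_mk_symm hy]
  change (trivializationAt F E x₀).symmₗ ℂ x₀ (part01 (diff (V := V) _ x₀) _) =
    (trivializationAt F E x₀).symmₗ ℂ x₀ (part01 (diff (V := V) _ x₀) _)
  rw [mvfderiv_congr (hrep Y), mvfderiv_congr (hrep X), part01_diff_comm hs hX hY]

theorem Sec.add_apply (s t : Sec V F E) (x : M) : (s + t) x = s x + t x := rfl

theorem Sec.sub_apply (s t : Sec V F E) (x : M) : (s - t) x = s x - t x := rfl

theorem SmoothEnd.act_apply (A : SmoothEnd V F E) (s : Sec V F E) (x : M) :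
    A.act s x = A.toFun x (s x) := rfl

theorem RealStructure.act_apply (κ : RealStructure V F E) (s : Sec V F E) (x : M) :
    κ.act s x = κ.toFun x (s x) := rfl

theorem Form10.op_apply (Φ : Form10 V F E) (X : VF V M) (s : Sec V F E) (x : M) :
    Φ.op X s x = Φ.toFun x (X.val x) (s x) := rfl

theorem Conn10.op_apply (nabla : Conn10 V F E) (X : VF V M) (s : Sec V F E) (x : M) :
    nabla.op X s x = nabla.toFun s x (X.val x) := rfl

theorem dbarOp_apply (X : VF V M) (s : Sec V F E) (x : M) :
    dbarOp V F E X s x = dbar s x (X.val x) := rfl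

theorem SmoothEnd.dbarEnd_apply (A : SmoothEnd V F E) (X : VF V M) (s : Sec V F E) (x : M) :
    A.dbarEnd X s x = dbar (A.act s) x (X.val x) - A.toFun x (dbar s x (X.val x)) := rfl

theorem SmoothEnd.toFun_add (A B : SmoothEnd V F E) (x : M) :
    (A + B).toFun x = A.toFun x + B.toFun x := rfl

theorem SmoothEnd.toFun_sub (A B : SmoothEnd V F E) (x : M) :
    (A - B).toFun x = A.toFun x - B.toFun x := rfl

theorem SmoothEnd.toFun_bracket (A B : SmoothEnd V F E) (x : M) :
    ⁅A, B⁆.toFun x = A.toFun x * B.toFun x - B.toFun x * A.toFun x := rfl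

theorem Form10.toFun_bracket (A : SmoothEnd V F E) (Φ : Form10 V F E) (x : M) (v : V) :
    ⁅A, Φ⁆.toFun x v = A.toFun x * Φ.toFun x v - Φ.toFun x v * A.toFun x := rfl

theorem Conn10.toFun_add (nabla : Conn10 V F E) (Φ : Form10 V F E) (s : Sec V F E) (x : M)
    (v : V) : (nabla + Φ).toFun s x v = nabla.toFun s x v + Φ.toFun x v (s x) := rfl

theorem Conn10.toFun_sub (nabla : Conn10 V F E) (Φ : Form10 V F E) (s : Sec V F E) (x : M)
    (v : V) : (nabla - Φ).toFun s x v = nabla.toFun s x v - Φ.toFun x v (s x) := rfl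

theorem dbar_sub (s t : Sec V F E) (x : M) (v : V) :
    dbar (s - t) x v = dbar s x v - dbar t x v := by
  rw [eq_sub_iff_add_eq, ← dbar_add, sub_add_cancel]

theorem Conn10.map_sub (nabla : Conn10 V F E) (s t : Sec V F E) (x : M) (v : V) :
    nabla.toFun (s - t) x v = nabla.toFun s x v - nabla.toFun t x v := by
  rw [eq_sub_iff_add_eq, ← nabla.map_add, sub_add_cancel]

/-- `d''[A, B] = [d''A, B] + [A, d''B]`. -/
theorem SmoothEnd.dbarEnd_bracket (A B : SmoothEnd V F E) (X : VF V M) (s : Sec V F E) (x : M) :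
    ⁅A, B⁆.dbarEnd X s x = A.dbarEnd X (B.act s) x - B.toFun x (A.dbarEnd X s x) +
      (A.toFun x (B.dbarEnd X s x) - B.dbarEnd X (A.act s) x) := by
  have h : ⁅A, B⁆.act s = A.act (B.act s) - B.act (A.act s) := rfl
  simp only [dbarEnd_apply, h, dbar_sub, toFun_bracket, LinearMap.sub_apply, Module.End.mul_apply,
    map_sub]
  abel

theorem SmoothEnd.dbarEnd_add (A B : SmoothEnd V F E) (X : VF V M) (s : Sec V F E) (x : M) :
    (A + B).dbarEnd X s x = A.dbarEnd X s x + B.dbarEnd X s x := by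
  have h : (A + B).act s = A.act s + B.act s := rfl
  simp only [dbarEnd_apply, h, dbar_add, toFun_add, LinearMap.add_apply]
  abel

theorem SmoothEnd.dbarEnd_sub (A B : SmoothEnd V F E) (X : VF V M) (s : Sec V F E) (x : M) :
    (A - B).dbarEnd X s x = A.dbarEnd X s x - B.dbarEnd X s x := by
  have h : (A - B).act s = A.act s - B.act s := rfl
  simp only [dbarEnd_apply, h, dbar_sub, toFun_sub, LinearMap.sub_apply]
  abel

theorem SmoothEnd.IsHolomorphic.apply {A : SmoothEnd V F E} (hA : A.IsHolomorphic) (X : VF V M)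
    (s : Sec V F E) (x : M) : A.dbarEnd X s x = 0 := by
  rw [hA X s]; rfl

/-! ### Decomposition of operators into types -/

/-- Operators which are additive, homogeneous under multiplication of sections by `i`, and
multiplied by `c` when the vector field is multiplied by `i`. -/
structure Op.IsOfType (P : Op V F E) (c : ℂ) : Prop where
  map_add : ∀ X s t x, P X (s + t) x = P X s x + P X t x
  map_smul : ∀ X (a : ℂ) s x, P X (s.fsmul (fun _ => a) contMDiff_const) x = a • P X s x
  map_J : ∀ X s, P X.J s = (P X s).fsmul (fun _ => c) contMDiff_const

/-- If the square of the sum of a `(1,0)`-operator `P` and of a `(0,1)`-operator `R` vanishes, then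
so do the parts of type `(2,0)` and `(1,1)`. -/
theorem CoordCommute.types {P R : Op V F E} (hP : P.IsOfType Complex.I)
    (hR : R.IsOfType (-Complex.I))
    (h : CoordCommute (fun X s => P X s + R X s) (fun X s => P X s + R X s)) :
    CoordCommute P P ∧ CoordCommute R P := by
  have key : ∀ (x₀ : M) (v w : V) (X Y : VF V M), IsCoordField x₀ v X → IsCoordField x₀ w Y →
      ∀ s : Sec V F E, P X (P Y s) x₀ - P Y (P X s) x₀ = 0 ∧
        R X (P Y s) x₀ - P Y (R X s) x₀ = 0 := by
    intro x₀ v w X Y hX hY s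
    -- The commutator splits into `[P_X, P_Y]`, `[P_X, R_Y]`, `[R_X, P_Y]`, `[R_X, R_Y]`. Replacing
    -- `X` or `Y` by its multiple by `i` multiplies these by known powers of `i`, so the four
    -- choices give four independent relations.
    have e1 := h x₀ _ _ X Y hX hY s
    have e2 := h x₀ _ _ X.J Y hX.J hY s
    have e3 := h x₀ _ _ X Y.J hX hY.J s
    have e4 := h x₀ _ _ X.J Y.J hX.J hY.J s
    simp only [hP.map_J, hR.map_J, Sec.add_apply, hP.map_add, hR.map_add, hP.map_smul, hR.map_smul,
      Sec.fsmul_apply, smul_add, smul_smul, mul_neg, neg_mul, Complex.I_mul_I, neg_neg] at e1 e2 e3 e4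
    generalize P X (P Y s) x₀ = a₁ at *
    generalize P Y (P X s) x₀ = a₂ at *
    generalize P X (R Y s) x₀ = b₁ at *
    generalize R Y (P X s) x₀ = b₂ at *
    generalize R X (P Y s) x₀ = c₁ at *
    generalize P Y (R X s) x₀ = c₂ at *
    generalize R X (R Y s) x₀ = d₁ at *
    generalize R Y (R X s) x₀ = d₂ at *
    -- Relations with a single factor `i` in each term are divided by `i`.
    have e2' : (a₁ - a₂) + (b₁ - b₂) - (c₁ - c₂) - (d₁ - d₂) = 0 := by
      refine (smul_eq_zero.1 (?_ : Complex.I • (_ : E x₀) = 0)).resolve_left Complex.I_ne_zero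
      rw [← sub_eq_zero] at e2
      rw [← e2]
      module
    have e3' : (a₁ - a₂) - (b₁ - b₂) + (c₁ - c₂) - (d₁ - d₂) = 0 := by
      refine (smul_eq_zero.1 (?_ : Complex.I • (_ : E x₀) = 0)).resolve_left Complex.I_ne_zero
      rw [← sub_eq_zero] at e3
      rw [← e3]
      module
    rw [← sub_eq_zero] at e1 e4
    constructor
    -- In the order `a, b, c, d`, the signs are `++++`, `++--`, `+-+-` and `-++-`. The first
    -- combination isolates `a`, of type `(2,0)`; the second isolates `c`, where `R` takes `X` and
    -- `P` takes `Y`.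
    · linear_combination (norm := module) (1 / 4 : ℂ) • (e1 + e2' + e3' - e4)
    · linear_combination (norm := module) (1 / 4 : ℂ) • (e1 - e2' + e3' + e4)
  exact ⟨fun x₀ v w X Y hX hY s => sub_eq_zero.1 (key x₀ v w X Y hX hY s).1,
    fun x₀ v w X Y hX hY s => sub_eq_zero.1 (key x₀ v w X Y hX hY s).2⟩

end Calculus

/-! ### Duality with respect to `h`, and consequences of the flatness of `D + Φ + Φ^†`. -/

section Adjoints

variable {V : Type*} [NormedAddCommGroup V] [NormedSpace ℂ V]
  {M : Type*} [TopologicalSpace M] [ChartedSpace V M]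
  {F : Type*} [NormedAddCommGroup F] [NormedSpace ℂ F]
  {E : M → Type*} [TopologicalSpace (TotalSpace F E)] [∀ x, TopologicalSpace (E x)]
  [∀ x, AddCommGroup (E x)] [∀ x, Module ℂ (E x)] [FiberBundle F E]
  [VectorBundle ℂ F E] [ContMDiffVectorBundle ω F E 𝓘(ℂ, V)] [IsManifold 𝓘(ℂ, V) ω M]
  [FiniteDimensional ℂ V] [FiniteDimensional ℂ F] [T2Space M]

theorem HermForm.apply_adj (h : HermForm V F E) (A : SmoothEnd V F E) (x : M) (u w : E x) :
    h.toFun x u ((h.adj A).toFun x w) = h.toFun x (A.toFun x u) w := h.apply_adjAt x _ u w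

theorem HermForm.adj_apply (h : HermForm V F E) (A : SmoothEnd V F E) (x : M) (u w : E x) :
    h.toFun x ((h.adj A).toFun x u) w = h.toFun x u (A.toFun x w) := by
  rw [← h.conj_symm, h.apply_adj, h.conj_symm]

theorem HermForm.adjOp_apply (h : HermForm V F E) (Φ : Form10 V F E) (X : VF V M) (s : Sec V F E)
    (x : M) : h.adjOp Φ X s x = h.adjAt x (Φ.toFun x (X.val x)) (s x) := rfl

theorem HermForm.apply_adjOp (h : HermForm V F E) (Φ : Form10 V F E) (X : VF V M)
    (s : Sec V F E) (x : M) (u : E x) :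
    h.toFun x u (h.adjOp Φ X s x) = h.toFun x (Φ.toFun x (X.val x) u) (s x) :=
  h.apply_adjAt x _ _ _

theorem HermForm.adjOp_apply' (h : HermForm V F E) (Φ : Form10 V F E) (X : VF V M)
    (s : Sec V F E) (x : M) (u : E x) :
    h.toFun x (h.adjOp Φ X s x) u = h.toFun x (s x) (Φ.toFun x (X.val x) u) := by
  rw [← h.conj_symm, h.apply_adjOp, h.conj_symm]

@[simp] theorem HermForm.adj_adj (h : HermForm V F E) (A : SmoothEnd V F E) :
    h.adj (h.adj A) = A :=
  SmoothEnd.ext (funext fun x => LinearMap.ext fun w => h.ext_right fun u => by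
    rw [h.apply_adj, h.adj_apply])

/-- Two vectors agree if they have the same pairings with the values of all sections. -/
theorem HermForm.ext_sec_left (h : HermForm V F E) {x : M} {w w' : E x}
    (hw : ∀ t : Sec V F E, h.toFun x w (t x) = h.toFun x w' (t x)) : w = w' :=
  h.ext_left fun u => by simpa only [extSec_apply_self] using hw (extSec V F u)

theorem HermForm.ext_sec_right (h : HermForm V F E) {x : M} {w w' : E x}
    (hw : ∀ t : Sec V F E, h.toFun x (t x) w = h.toFun x (t x) w') : w = w' :=
  h.ext_right fun u => by simpa only [extSec_apply_self] using hw (extSec V F u)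

theorem Form10.ext_sec {Φ Ψ : Form10 V F E}
    (hΦ : ∀ (x : M) (v : V) (s : Sec V F E), Φ.toFun x v (s x) = Ψ.toFun x v (s x)) : Φ = Ψ :=
  Form10.ext (funext fun x => LinearMap.ext fun v => LinearMap.ext fun u => by
    simpa only [extSec_apply_self] using hΦ x v (extSec V F u))

/-- The `(1,0)`-part of the compatibility of the Chern connection with `h`. -/
theorem HermForm.del_apply (h : HermForm V F E) (s t : Sec V F E) (x : M) (v : V) :
    del (V := V) (fun y => h.toFun y (s y) (t y)) x v =
      h.toFun x (h.chern.toFun s x v) (t x) + h.toFun x (s x) (dbar t x v) := by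
  change _ = h.toFun x (h.chernAt s x v) (t x) + _
  rw [h.chernAt_apply, HermForm.defect]
  ring

/-- `D'(A^†) = (d''A)^†`. -/
theorem HermForm.dEnd_adj (h : HermForm V F E) (A : SmoothEnd V F E) (X : VF V M)
    (s t : Sec V F E) (x : M) :
    h.toFun x ((h.chern.dEnd (h.adj A)).toFun x (X.val x) (s x)) (t x) =
      h.toFun x (s x) (A.dbarEnd X t x) := by
  -- The function `h(A^†s, t) = h(s, At)` is differentiated in both forms. After moving `A^†` across
  -- `h`, the comparison leaves exactly `D'(A^†)` on one side and `d''A` on the other.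
  have h1 := h.del_apply ((h.adj A).act s) t x (X.val x)
  have h2 := h.del_apply s (A.act t) x (X.val x)
  have h3 : (fun y => h.toFun y ((h.adj A).act s y) (t y)) =
      fun y => h.toFun y (s y) (A.act t y) := funext fun y => h.adj_apply A y _ _
  rw [h3, h2] at h1
  rw [Conn10.dEnd_apply, SmoothEnd.dbarEnd_apply, _root_.map_sub, LinearMap.sub_apply,
    _root_.map_sub, h.adj_apply]
  rw [SmoothEnd.act_apply, SmoothEnd.act_apply, h.adj_apply] at h1
  linear_combination -h1

/-- `Φ = D'(A^†)` if and only if `Φ^† = d''A`. -/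
theorem HermForm.adjOp_eq_iff (h : HermForm V F E) (A : SmoothEnd V F E) (Φ : Form10 V F E) :
    h.adjOp Φ = A.dbarEnd ↔ h.chern.dEnd (h.adj A) = Φ := by
  constructor
  · intro hΦ
    refine Form10.ext_sec fun x v s => h.ext_sec_left fun t => ?_
    obtain ⟨X, rfl⟩ := exists_vf_val x v
    rw [h.dEnd_adj, ← hΦ, h.apply_adjOp]
  · rintro rfl
    refine funext fun X => funext fun t => ?_
    ext x
    refine h.ext_sec_right fun s => ?_
    rw [h.apply_adjOp, h.dEnd_adj]

/-- The Chern connection satisfies `D'² = 0`. -/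
theorem HermForm.chern_isFlat (h : HermForm V F E) : h.chern.IsFlat := by
  intro x₀ v w X Y hX hY s
  refine h.ext_sec_left fun t => ?_
  -- In the expansion of `∂_X ∂_Y h(s, t)` the two cross terms are exchanged with `X` and `Y`, the
  -- last term is symmetric by `d''² = 0`, and the left side is symmetric by `∂² = 0`. Hence `h(D'_X
  -- D'_Y s, t)` is symmetric as well.
  have key (X Y : VF V M) :
      del (V := V) (fun y => del (V := V) (fun z => h.toFun z (s z) (t z)) y (Y.val y)) x₀
        (X.val x₀) = h.toFun x₀ (h.chern.op X (h.chern.op Y s) x₀) (t x₀) +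
          h.toFun x₀ (h.chern.op Y s x₀) (dbarOp V F E X t x₀) +
          (h.toFun x₀ (h.chern.op X s x₀) (dbarOp V F E Y t x₀) +
          h.toFun x₀ (s x₀) (dbarOp V F E X (dbarOp V F E Y t) x₀)) := by
    have h1 : (fun y => del (V := V) (fun z => h.toFun z (s z) (t z)) y (Y.val y)) =
        fun y => h.toFun y (h.chern.op Y s y) (t y) + h.toFun y (s y) (dbarOp V F E Y t y) :=
      funext fun y => h.del_apply s t y _
    rw [h1, del_add (h.smooth _ _) (h.smooth _ _), h.del_apply, h.del_apply]
    rfl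
  have h1 := del_del_comm (h.smooth s t x₀) hX hY
  rw [key X Y, key Y X, dbarOp_comm x₀ v w X Y hX hY] at h1
  linear_combination h1

/-- `D'(Φ^†) = 0` if `d''(Φ) = 0`. -/
theorem HermForm.chern_adjOp_comm (h : HermForm V F E) {Φ : Form10 V F E}
    (hΦ : Φ.IsHolomorphic) : CoordCommute h.chern.op (h.adjOp Φ) := by
  intro x₀ v w X Y hX hY s
  refine h.ext_sec_left fun t => ?_
  -- The function `h(Φ^†_Y s, t) = h(s, Φ_Y t)` is differentiated along `X` in both forms;
  -- holomorphy of `Φ` moves `d''_X` past `Φ_Y`.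
  have h1 := h.del_apply (h.adjOp Φ Y s) t x₀ (X.val x₀)
  have h2 := h.del_apply s (Φ.op Y t) x₀ (X.val x₀)
  have h3 : (fun y => h.toFun y (h.adjOp Φ Y s y) (t y)) =
      fun y => h.toFun y (s y) (Φ.op Y t y) := funext fun y => h.adjOp_apply' Φ Y s y _
  have h4 := congrArg (h.toFun x₀ (s x₀)) (hΦ x₀ v w X Y hX hY t)
  rw [dbarOp_apply, Form10.op_apply, dbarOp_apply] at h4
  rw [h3, h2, h.adjOp_apply', h4, Form10.op_apply] at h1
  rw [h.adjOp_apply', Conn10.op_apply, Conn10.op_apply]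
  linear_combination -h1

/-- Adjoints of commuting endomorphisms commute: this is `Φ^† ∧ Φ^† = 0`, the condition `Ψ ∧ Ψ = 0`
of a harmonic potential Saito structure. -/
theorem HermForm.adjOp_comm (h : HermForm V F E) {Φ : Form10 V F E} (hΦ : Φ.WedgeSelfZero) :
    CoordCommute (h.adjOp Φ) (h.adjOp Φ) := by
  intro x₀ v w X Y hX hY s
  refine h.ext_left fun u => ?_
  rw [h.adjOp_apply', h.adjOp_apply', h.adjOp_apply', h.adjOp_apply', ← Module.End.mul_apply,
    hΦ, Module.End.mul_apply]

/-- Together with `isOfType_dbar_add`, this makes `CoordCommute.types` applicable to the connection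
`D + Φ + Φ^†`. Homogeneity in the section holds because `∂` kills constants. -/
theorem HermForm.isOfType_chern_add (h : HermForm V F E) (Φ : Form10 V F E) :
    Op.IsOfType (fun X s => h.chern.op X s + Φ.op X s) Complex.I where
  map_add X s t x := by
    simp only [Sec.add_apply, Conn10.op_apply, Form10.op_apply, Conn10.map_add, _root_.map_add]
    abel
  map_smul X a s x := by
    have : del (V := V) (fun _ : M => a) x (X.val x) = 0 := by
      have h0 (v : V) : diff (V := V) (fun _ : M => a) x v = 0 := by
        change mfderiv 𝓘(ℝ, V) 𝓘(ℝ, ℂ) (fun _ : M => a) x v = 0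
        rw [mfderiv_const]
        rfl
      simp [del, part10, h0]
    simp only [Sec.add_apply, Conn10.op_apply, Form10.op_apply, Conn10.leibniz, Sec.fsmul_apply,
      _root_.map_smul, this, zero_smul, add_zero, smul_add]
  map_J X s := by
    ext x
    simp only [Sec.add_apply, Conn10.op_apply, Form10.op_apply, VF.J_val, _root_.map_smul,
      Sec.fsmul_apply, smul_add, LinearMap.smul_apply]

/-- The factor is `-i` because `d''_v` is conjugate-linear in `v`, and so is `(Φ_v)^†`, since taking
the adjoint conjugates scalars. -/
theorem HermForm.isOfType_dbar_add (h : HermForm V F E) (Φ : Form10 V F E) :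
    Op.IsOfType (fun X s => dbarOp V F E X s + h.adjOp Φ X s) (-Complex.I) where
  map_add X s t x := by
    simp only [Sec.add_apply, dbarOp_apply, h.adjOp_apply, dbar_add, _root_.map_add]
    abel
  map_smul X a s x := by
    have : delbar (V := V) (fun _ : M => a) x (X.val x) = 0 := by
      have h0 (v : V) : diff (V := V) (fun _ : M => a) x v = 0 := by
        change mfderiv 𝓘(ℝ, V) 𝓘(ℝ, ℂ) (fun _ : M => a) x v = 0
        rw [mfderiv_const]
        rfl
      simp [delbar, part01, h0]
    simp only [Sec.add_apply, dbarOp_apply, h.adjOp_apply, dbar_fsmul, Sec.fsmul_apply,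
      _root_.map_smul, this, zero_smul, add_zero, smul_add]
  map_J X s := by
    ext x
    have h1 : h.adjOp Φ X.J s x = (-Complex.I) • h.adjOp Φ X s x := h.ext_left fun u => by
      rw [h.adjOp_apply', _root_.map_smul, LinearMap.smul_apply, h.adjOp_apply', VF.J_val,
        _root_.map_smul, LinearMap.smul_apply, LinearMap.map_smulₛₗ, Complex.conj_I]
    rw [Sec.fsmul_apply, Sec.add_apply, Sec.add_apply, h1, dbarOp_apply, dbarOp_apply, VF.J_val,
      LinearMap.map_smulₛₗ, Complex.conj_I, smul_add]

/-- On a harmonic Higgs bundle, `D'(Φ) = 0`. -/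
theorem IsHarmonicHiggs.chern_parallel {h : HermForm V F E} {Φ : Form10 V F E}
    (H : IsHarmonicHiggs h Φ) : h.chern.FormParallel Φ := by
  have hop : h.higgsOp Φ = fun X s =>
      (h.chern.op X s + Φ.op X s) + (dbarOp V F E X s + h.adjOp Φ X s) := by
    funext X s
    simp only [HermForm.higgsOp]
    abel
  have hflat := H.flat
  rw [hop] at hflat
  -- The `(2,0)`-part of flatness is `(D' + Φ)² = 0`; removing `D'² = 0` and `Φ ∧ Φ = 0` leaves
  -- `D'(Φ) = 0`.
  have h20 := (CoordCommute.types (h.isOfType_chern_add Φ) (h.isOfType_dbar_add Φ) hflat).1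
  intro x₀ v w X Y hX hY s
  have e := h20 x₀ v w X Y hX hY s
  have e1 := h.chern_isFlat x₀ v w X Y hX hY s
  have e2 : Φ.op X (Φ.op Y s) x₀ = Φ.op Y (Φ.op X s) x₀ :=
    LinearMap.congr_fun (H.wedge x₀ (X.val x₀) (Y.val x₀)) (s x₀)
  simp only [Sec.add_apply, Conn10.op_apply, Form10.op_apply, Conn10.map_add, _root_.map_add]
    at e e1 e2
  simp only [Sec.sub_apply, Conn10.op_apply, Form10.op_apply]
  linear_combination (norm := module) e - e1 - e2

/-- On a harmonic Higgs bundle, the part of type `(1,1)` of the curvature of the Chern connection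
is `-(Φ Φ^† + Φ^† Φ)`. -/
theorem IsHarmonicHiggs.curvature {h : HermForm V F E} {Φ : Form10 V F E}
    (H : IsHarmonicHiggs h Φ) {x₀ : M} {v w : V} {X Y : VF V M} (hX : IsCoordField x₀ v X)
    (hY : IsCoordField x₀ w Y) (s : Sec V F E) :
    dbarOp V F E X (h.chern.op Y s) x₀ - h.chern.op Y (dbarOp V F E X s) x₀ +
      (h.adjOp Φ X (Φ.op Y s) x₀ - Φ.op Y (h.adjOp Φ X s) x₀) = 0 := by
  have hop : h.higgsOp Φ = fun X s =>
      (h.chern.op X s + Φ.op X s) + (dbarOp V F E X s + h.adjOp Φ X s) := by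
    funext X s
    simp only [HermForm.higgsOp]
    abel
  have hflat := H.flat
  rw [hop] at hflat
  -- In the `(1,1)`-part the mixed terms are `d''(Φ)`, zero by holomorphy, and `D'(Φ^†)`, its
  -- `h`-dual.
  have h11 := (CoordCommute.types (h.isOfType_chern_add Φ) (h.isOfType_dbar_add Φ) hflat).2
  have e := h11 x₀ v w X Y hX hY s
  have e1 := H.holomorphic x₀ v w X Y hX hY s
  have e2 := h.chern_adjOp_comm H.holomorphic x₀ w v Y X hY hX s
  simp only [Sec.add_apply, Conn10.op_apply, Form10.op_apply, dbarOp_apply, h.adjOp_apply, dbar_add,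
    Conn10.map_add, _root_.map_add] at e e1 e2 ⊢
  linear_combination (norm := module) e - e1 + e2

/-- If `Q^† = Q`, then `D'(Q) + [Φ, U^†] = 0` if and only if `d''(Q) = [Φ^†, U]`. -/
theorem HermForm.dEnd_add_comm_eq_zero_iff (h : HermForm V F E) {Q U : SmoothEnd V F E}
    (hQ : h.adj Q = Q) (Φ : Form10 V F E) :
    (∀ x v, (h.chern.dEnd Q).toFun x v + (Φ.toFun x v * (h.adj U).toFun x -
      (h.adj U).toFun x * Φ.toFun x v) = 0) ↔
    ∀ X s x, Q.dbarEnd X s x = h.adjOp Φ X (U.act s) x - U.toFun x (h.adjOp Φ X s x) := by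
  -- The two equations are `h`-adjoint to each other: `D'(Q)` is the adjoint of `d''Q` because `Q^†
  -- = Q`, and the adjoint of `[Φ, U^†]` is `-[Φ^†, U]`.
  have key (X : VF V M) (s t : Sec V F E) (x : M) :
      h.toFun x (((h.chern.dEnd Q).toFun x (X.val x) + (Φ.toFun x (X.val x) * (h.adj U).toFun x -
        (h.adj U).toFun x * Φ.toFun x (X.val x))) (s x)) (t x) =
      h.toFun x (s x) (Q.dbarEnd X t x -
        (h.adjOp Φ X (U.act t) x - U.toFun x (h.adjOp Φ X t x))) := by
    have h1 := h.dEnd_adj Q X s t x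
    rw [hQ] at h1
    simp only [LinearMap.add_apply, LinearMap.sub_apply, Module.End.mul_apply, _root_.map_add,
      _root_.map_sub, h1, h.adj_apply, h.apply_adjOp, SmoothEnd.act_apply]
    rw [← h.adj_apply U x _ (h.adjOp Φ X t x), h.apply_adjOp]
    ring
  constructor
  · intro H X t x
    rw [← sub_eq_zero]
    refine h.ext_sec_right fun s => ?_
    rw [← key, H]
    simp
  · intro H x v
    obtain ⟨X, rfl⟩ := exists_vf_val x v
    refine LinearMap.ext fun u => h.ext_sec_left fun t => ?_
    have := key X (extSec V F u) t x
    rw [extSec_apply_self, H, sub_self] at this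
    rw [this]
    simp

end Adjoints

/-! ### Real structures, `g`-adjoints, and the change of connection by `[A, Φ]`. -/

section Real

variable {V : Type*} [NormedAddCommGroup V] [NormedSpace ℂ V]
  {M : Type*} [TopologicalSpace M] [ChartedSpace V M]
  {F : Type*} [NormedAddCommGroup F] [NormedSpace ℂ F]
  {E : M → Type*} [TopologicalSpace (TotalSpace F E)] [∀ x, TopologicalSpace (E x)]
  [∀ x, AddCommGroup (E x)] [∀ x, Module ℂ (E x)] [FiberBundle F E]
  [VectorBundle ℂ F E] [ContMDiffVectorBundle ω F E 𝓘(ℂ, V)] [IsManifold 𝓘(ℂ, V) ω M]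

theorem HermForm.bilin_apply (h : HermForm V F E) (κ : RealStructure V F E) (hκ : h.IsReal κ)
    (x : M) (u w : E x) : (h.bilin κ hκ).toFun x u w = h.toFun x u (κ.toFun x w) := rfl

theorem SymForm.herm_apply (g : SymForm V F E) (κ : RealStructure V F E) (hg : g.IsReal κ)
    (x : M) (u w : E x) : (g.herm κ hg).toFun x u w = g.toFun x u (κ.toFun x w) := rfl

theorem SymForm.IsReal.herm {g : SymForm V F E} {κ : RealStructure V F E} (hg : g.IsReal κ) :
    (g.herm κ hg).IsReal κ := fun x u w => by
  rw [g.herm_apply, g.herm_apply, ← hg.conj_apply]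

/-- Composing the second variable with `κ` twice does nothing; with `HermForm.herm_bilin`, this
makes `g` and `h` interchangeable data once `κ` is given. -/
theorem SymForm.bilin_herm (g : SymForm V F E) (κ : RealStructure V F E) (hg : g.IsReal κ) :
    (g.herm κ hg).bilin κ hg.herm = g :=
  SymForm.ext (funext fun x => LinearMap.ext fun u => LinearMap.ext fun w => by
    rw [HermForm.bilin_apply, g.herm_apply, κ.involutive])

theorem HermForm.IsReal.bilin {h : HermForm V F E} {κ : RealStructure V F E} (hκ : h.IsReal κ) :
    (h.bilin κ hκ).IsReal κ := fun x u w hu hw => by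
  rw [h.bilin_apply, ← hκ, κ.involutive, hu, hw]

theorem HermForm.herm_bilin (h : HermForm V F E) (κ : RealStructure V F E) (hκ : h.IsReal κ) :
    (h.bilin κ hκ).herm κ hκ.bilin = h :=
  HermForm.ext (funext fun x => LinearMap.ext fun u => LinearMap.ext fun w => by
    rw [SymForm.herm_apply, h.bilin_apply, κ.involutive])

/-- The `g`-adjoint reverses products and so changes the sign of the bracket. Applied to `[A^†, U]`,
this shows that `V` and `Q` are `g`-skew simultaneously. -/
theorem SymForm.SelfAdj.bracket_skewAdj {g : SymForm V F E} {A B : SmoothEnd V F E}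
    (hA : g.SelfAdj A) (hB : g.SelfAdj B) : g.SkewAdj ⁅A, B⁆ := fun x u w => by
  simp only [SmoothEnd.toFun_bracket, LinearMap.sub_apply, Module.End.mul_apply, map_sub,
    hA x, hB x]
  ring

variable [FiniteDimensional ℂ V] [FiniteDimensional ℂ F] [T2Space M]

/-- The `h`-adjoint of a `g`-selfadjoint endomorphism is `g`-selfadjoint. -/
theorem HermForm.selfAdj_adj (h : HermForm V F E) {κ : RealStructure V F E} (hκ : h.IsReal κ)
    {A : SmoothEnd V F E} (hA : (h.bilin κ hκ).SelfAdj A) : (h.bilin κ hκ).SelfAdj (h.adj A) := by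
  intro x u w
  rw [h.bilin_apply, h.adj_apply]
  rw [(h.bilin κ hκ).symm, h.bilin_apply, h.adj_apply]
  -- In operator form `A^* = κ A^† κ`. So `A^* = A` means `A^† = κ A κ`, a condition symmetric in
  -- `A` and `A^†`; this is why the hypothesis is used at `κu` and `κw`.
  have h1 := hA x (κ.toFun x u) (κ.toFun x w)
  rw [h.bilin_apply, h.bilin_apply, κ.involutive] at h1
  rw [← h.conj_symm x (A.toFun x (κ.toFun x u)), h1, ← hκ, κ.involutive, κ.involutive]

/-- If `D(g) = 0` then `D(κ) = 0`. -/
theorem HermForm.D_real_of_parallel (h : HermForm V F E) {κ : RealStructure V F E}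
    (hκ : h.IsReal κ) (hg : (h.bilin κ hκ).IsHolomorphic)
    (hg' : (h.bilin κ hκ).IsParallel h.chern) (t : Sec V F E) (x : M) (v : V) :
    h.chern.toFun (κ.act t) x v + dbar (κ.act t) x v =
      κ.toFun x (h.chern.toFun t x v + dbar t x v) := by
  refine h.ext_sec_right fun s => ?_
  -- The function `h(s, κt) = g(s, t)` is differentiated by the Chern property and by `D(g) = 0`.
  -- The terms in `Ds` coincide, so `h(s, D(κt)) = h(s, κ(Dt))` for every `s`.
  have h1 := h.chern_spec s (κ.act t) x v
  have h2 := hg s t x v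
  have h3 := hg' s t x v
  have h4 := part10_add_part01 (diff (V := V) (fun y => h.toFun y (s y) (κ.act t y)) x) v
  have h5 : part10 (diff (V := V) (fun y => h.toFun y (s y) (κ.act t y)) x) v = _ := h3
  have h6 : part01 (diff (V := V) (fun y => h.toFun y (s y) (κ.act t y)) x) v = _ := h2
  rw [h5, h6] at h4
  simp only [h.bilin_apply] at h4
  simp only [RealStructure.act_apply, _root_.map_add, LinearMap.add_apply] at h1 h4 ⊢
  linear_combination -h1 - h4

/-- If `D(κ) = 0` then `D(g) = 0`. -/
theorem HermForm.parallel_of_D_real (h : HermForm V F E) {κ : RealStructure V F E}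
    (hκ : h.IsReal κ) (hD : ∀ (s : Sec V F E) (x : M) (v : V),
      h.chern.toFun (κ.act s) x v + dbar (κ.act s) x v =
        κ.toFun x (h.chern.toFun s x v + dbar s x v)) :
    (h.bilin κ hκ).IsHolomorphic ∧ (h.bilin κ hκ).IsParallel h.chern := by
  have key (s t : Sec V F E) (x : M) (v : V) :
      diff (V := V) (fun y => (h.bilin κ hκ).toFun y (s y) (t y)) x v =
        (h.bilin κ hκ).toFun x (h.chern.toFun s x v) (t x) +
        (h.bilin κ hκ).toFun x (dbar s x v) (t x) +
        ((h.bilin κ hκ).toFun x (s x) (h.chern.toFun t x v) +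
        (h.bilin κ hκ).toFun x (s x) (dbar t x v)) := by
    rw [← LinearMap.add_apply, ← _root_.map_add, ← _root_.map_add]
    refine (h.chern_spec s (κ.act t) x v).trans ?_
    rw [hD]
    rfl
  -- `key` is the full identity `D(g) = 0`. Its `D'` terms are complex-linear in `v` and its `d''`
  -- terms conjugate-linear, so projecting to types separates the two claims.
  constructor
  · intro s t x v
    simp only [delbar, part01, LinearMap.coe_mk, AddHom.coe_mk, key, LinearMap.map_smulₛₗ,
      RingHom.id_apply, LinearMap.smul_apply, smul_eq_mul, Complex.conj_I]
    linear_combination (1 / 2 : ℂ) * ((h.bilin κ hκ).toFun x (h.chern.toFun s x v) (t x) +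
      (h.bilin κ hκ).toFun x (s x) (h.chern.toFun t x v) -
      (h.bilin κ hκ).toFun x (dbar s x v) (t x) -
      (h.bilin κ hκ).toFun x (s x) (dbar t x v)) * Complex.I_sq
  · intro s t x v
    simp only [del, part10, LinearMap.coe_mk, AddHom.coe_mk, key, LinearMap.map_smulₛₗ,
      RingHom.id_apply, LinearMap.smul_apply, smul_eq_mul, Complex.conj_I]
    linear_combination (1 / 2 : ℂ) * (-(h.bilin κ hκ).toFun x (h.chern.toFun s x v) (t x) -
      (h.bilin κ hκ).toFun x (s x) (h.chern.toFun t x v) +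
      (h.bilin κ hκ).toFun x (dbar s x v) (t x) +
      (h.bilin κ hκ).toFun x (s x) (dbar t x v)) * Complex.I_sq

/-- If `∇(g) = 0` and `A^* = A`, then `∇(A)^* = ∇(A)`. -/
theorem SymForm.IsParallel.formSelfAdj_dEnd {g : SymForm V F E} {nabla : Conn10 V F E}
    (hg : g.IsParallel nabla) {A : SmoothEnd V F E} (hA : g.SelfAdj A) :
    g.FormSelfAdj (nabla.dEnd A) := by
  have key (x : M) (v : V) (s t : Sec V F E) :
      g.toFun x ((nabla.dEnd A).toFun x v (s x)) (t x) =
        g.toFun x (s x) ((nabla.dEnd A).toFun x v (t x)) := by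
    -- Both forms of the function `g(As, t) = g(s, At)` are differentiated and compared.
    have h1 := hg (A.act s) t x v
    have h2 := hg s (A.act t) x v
    have h3 : (fun y => g.toFun y (A.act s y) (t y)) = fun y => g.toFun y (s y) (A.act t y) :=
      funext fun y => hA y _ _
    rw [h3, h2] at h1
    simp only [SmoothEnd.act_apply, hA x] at h1
    rw [← hA x] at h1
    rw [Conn10.dEnd_apply, Conn10.dEnd_apply, map_sub, map_sub, LinearMap.sub_apply]
    linear_combination -h1
  intro x v u w
  simpa only [extSec_apply_self] using key x v (extSec V F u) (extSec V F w)

/-- If `∇(g) = 0`, `A^* = A` and `Φ^* = Φ`, then `(∇ + [A, Φ])(g) = 0`. -/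
theorem SymForm.IsParallel.add_bracket {g : SymForm V F E} {nabla : Conn10 V F E}
    (hg : g.IsParallel nabla) {A : SmoothEnd V F E} {Φ : Form10 V F E} (hA : g.SelfAdj A)
    (hΦ : g.FormSelfAdj Φ) : g.IsParallel (nabla + ⁅A, Φ⁆) := by
  intro s t x v
  rw [hg s t x v]
  -- The bracket of two `g`-selfadjoint endomorphisms is `g`-skew, so the added terms cancel.
  simp only [Conn10.toFun_add, Form10.toFun_bracket, LinearMap.sub_apply, Module.End.mul_apply,
    map_add, map_sub, LinearMap.add_apply, hA x, hΦ x]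
  ring

/-- `(∇ + [A, Φ])(B) = ∇(B) + [[A, Φ], B]`. -/
theorem Conn10.dEnd_add (nabla : Conn10 V F E) (Ψ : Form10 V F E) (B : SmoothEnd V F E) (x : M)
    (v : V) : ((nabla + Ψ).dEnd B).toFun x v =
      (nabla.dEnd B).toFun x v + (Ψ.toFun x v * B.toFun x - B.toFun x * Ψ.toFun x v) := by
  refine LinearMap.ext fun u => ?_
  have h1 := (nabla + Ψ).dEnd_apply B (extSec V F u) x v
  have h2 := nabla.dEnd_apply B (extSec V F u) x v
  simp only [extSec_apply_self] at h1 h2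
  rw [h1, LinearMap.add_apply, h2]
  simp only [Conn10.toFun_add, SmoothEnd.act_apply, extSec_apply_self, LinearMap.sub_apply,
    Module.End.mul_apply, _root_.map_add]
  abel

theorem Conn10.sub_add_cancel (nabla : Conn10 V F E) (Ψ : Form10 V F E) :
    (nabla - Ψ : Conn10 V F E) + Ψ = nabla :=
  Conn10.ext (funext fun s => funext fun x => LinearMap.ext fun v => by
    rw [Conn10.toFun_add, Conn10.toFun_sub]; abel)

theorem Conn10.add_sub_cancel (nabla : Conn10 V F E) (Ψ : Form10 V F E) :
    (nabla + Ψ : Conn10 V F E) - Ψ = nabla :=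
  Conn10.ext (funext fun s => funext fun x => LinearMap.ext fun v => by
    rw [Conn10.toFun_sub, Conn10.toFun_add]; abel)

/-- The equations `∇(U) - [Φ, V] + Φ = 0` and `D'(U) - [Φ, Q] + Φ = 0` are equivalent if
`∇ = D' + [A, Φ]`, `Q = V + [A, U]` and `[Φ, U] = 0`. -/
theorem Conn10.dEnd_sub_comm_eq (D' : Conn10 V F E) (A U W Q : SmoothEnd V F E) (Φ : Form10 V F E)
    (hU : Φ.CommutesWith U) (hQ : Q = W + ⁅A, U⁆) (x : M) (v : V) :
    ((D' + ⁅A, Φ⁆).dEnd U).toFun x v -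
      (Φ.toFun x v * W.toFun x - W.toFun x * Φ.toFun x v) =
    (D'.dEnd U).toFun x v - (Φ.toFun x v * Q.toFun x - Q.toFun x * Φ.toFun x v) := by
  rw [Conn10.dEnd_add, hQ, SmoothEnd.toFun_add, SmoothEnd.toFun_bracket, Form10.toFun_bracket]
  have h1 := hU x v
  generalize (D'.dEnd U).toFun x v = d
  generalize Φ.toFun x v = p at *
  generalize U.toFun x = u at *
  generalize A.toFun x = a at *
  generalize W.toFun x = w at *
  -- The difference of the two sides is `[[A, Φ], U] + [Φ, [A, U]]`, which by the Jacobi identity is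
  -- `[A, [Φ, U]] = 0`.
  have h2 : a * (p * u) = a * (u * p) := by rw [h1]
  have h3 : u * p * a = p * u * a := by rw [h1]
  linear_combination (norm := noncomm_ring) h2 + h3

end Real

/-! ### The two constructions and the bijection. -/

section Correspondence

variable {V : Type*} [NormedAddCommGroup V] [NormedSpace ℂ V]
  {M : Type*} [TopologicalSpace M] [ChartedSpace V M]
  {F : Type*} [NormedAddCommGroup F] [NormedSpace ℂ F]
  {E : M → Type*} [TopologicalSpace (TotalSpace F E)] [∀ x, TopologicalSpace (E x)]
  [∀ x, AddCommGroup (E x)] [∀ x, Module ℂ (E x)] [FiberBundle F E]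
  [VectorBundle ℂ F E] [ContMDiffVectorBundle ω F E 𝓘(ℂ, V)] [IsManifold 𝓘(ℂ, V) ω M]
  [FiniteDimensional ℂ V] [FiniteDimensional ℂ F] [T2Space M]

theorem SmoothEnd.sub_add_cancel (A B : SmoothEnd V F E) : A - B + B = A :=
  SmoothEnd.ext (funext fun x => by rw [toFun_add, toFun_sub, _root_.sub_add_cancel])

theorem SmoothEnd.add_sub_cancel (A B : SmoothEnd V F E) : A + B - B = A :=
  SmoothEnd.ext (funext fun x => by rw [toFun_sub, toFun_add, _root_.add_sub_cancel_right])

namespace HarmonicPotentialRealSaito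

variable (S : HarmonicPotentialRealSaito V F E)

theorem h_isReal : S.h.IsReal S.κ := S.g_real.herm

theorem bilin_h : S.h.bilin S.κ S.h_isReal = S.g := S.g.bilin_herm S.κ S.g_real

theorem adj_A : S.h.adj S.A = S.Adag := S.h.adj_adj S.Adag

/-- This is the `h`-dual of the compatibility `Φ^† = d''A^†`; it identifies the Higgs field of the
`tt*` bundle with that of the Saito structure. -/
theorem chern_dEnd_A : S.h.chern.dEnd S.A = S.Φ := (S.h.adjOp_eq_iff S.Adag S.Φ).1 S.Φ_dag

theorem chern_add : S.h.chern + ⁅S.Adag, S.Φ⁆ = S.nabla := by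
  rw [show S.h.chern = _ from S.chern_eq, Conn10.sub_add_cancel]

/-- The potential `tt*` bundle associated with a harmonic potential real Saito structure. -/
noncomputable def toPotentialTTStar : PotentialTTStar V F E where
  h := S.h
  A := S.A
  κ := S.κ
  calU := S.calU
  calQ := S.calQ
  h_real := S.h_isReal
  D_κ := by
    -- `D(κ) = 0` needs both types of `D(g) = 0`: holomorphy of `g` gives the `d''`-part and
    -- `chern_g` the `D'`-part.
    refine S.h.D_real_of_parallel S.h_isReal ?_ ?_
    · rw [S.bilin_h]; exact S.g_holomorphic
    · rw [S.bilin_h]; exact S.chern_g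
  harmonic := by rw [S.chern_dEnd_A]; exact S.harmonic
  A_adj := S.h.selfAdj_adj S.h_isReal (by rw [S.bilin_h]; exact S.Adag_adj)
  calU_holomorphic := S.calU_holomorphic
  calQ_dag := S.calQ_dag
  calU_comm := by rw [S.chern_dEnd_A]; exact S.calU_comm
  D_calU x v := by
    rw [S.chern_dEnd_A, ← S.h.chern.dEnd_sub_comm_eq S.Adag S.calU S.calV S.calQ S.Φ S.calU_comm rfl,
      S.chern_add]
    exact S.nabla_calU x v
  D_calQ := by
    rw [S.chern_dEnd_A]
    -- In dual form the claim is `d''Q = [Φ^†, U]`. As `V` and `U` are holomorphic, `d''Q = [d''A^†,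
    -- U]`, and `d''A^† = Φ^†`.
    refine (S.h.dEnd_add_comm_eq_zero_iff S.calQ_dag S.Φ).2 fun X s x => ?_
    have h1 : S.h.adjOp S.Φ = S.Adag.dbarEnd := S.Φ_dag
    change (S.calV + ⁅S.Adag, S.calU⁆).dbarEnd X s x = _
    rw [h1, SmoothEnd.dbarEnd_add, SmoothEnd.dbarEnd_bracket, S.calV_holomorphic.apply,
      S.calU_holomorphic.apply, S.calU_holomorphic.apply, map_zero, sub_zero, zero_add, add_zero]
  calU_adj := by rw [S.bilin_h]; exact S.calU_adj
  calQ_adj := by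
    rw [S.bilin_h]
    intro x u w
    simp only [calQ, SmoothEnd.toFun_add, LinearMap.add_apply, map_add, S.calV_adj x,
      S.Adag_adj.bracket_skewAdj S.calU_adj x]
    ring

/-- This and the four lemmas that follow show that the objects associated with the `tt*` bundle are
the original Saito data. They give the left inverse, and those for `∇` and `V` also transport `∇² =
0` and `∇(V) = 0`. -/
theorem toPotentialTTStar_g : S.toPotentialTTStar.g = S.g := S.bilin_h

theorem toPotentialTTStar_Φ : S.toPotentialTTStar.Φ = S.Φ := S.chern_dEnd_A

theorem toPotentialTTStar_Adag : S.toPotentialTTStar.Adag = S.Adag := S.adj_A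

theorem toPotentialTTStar_nabla : S.toPotentialTTStar.nabla = S.nabla := by
  rw [PotentialTTStar.nabla, toPotentialTTStar_Φ, toPotentialTTStar_Adag]
  exact S.chern_add

theorem toPotentialTTStar_calV : S.toPotentialTTStar.calV = S.calV := by
  rw [PotentialTTStar.calV, toPotentialTTStar_Adag]
  exact SmoothEnd.add_sub_cancel _ _

/-- Harmonic potential real Saito structures agree if their data agree. -/
theorem ext_data {S T : HarmonicPotentialRealSaito V F E} (hn : S.nabla = T.nabla) (hg : S.g = T.g)
    (hΦ : S.Φ = T.Φ) (hU : S.calU = T.calU) (hV : S.calV = T.calV) (hκ : S.κ = T.κ)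
    (hA : S.Adag = T.Adag) : S = T := by
  have h0 : S.toSaitoStructure = T.toSaitoStructure := SaitoStructure.ext hn hg hΦ hU hV
  -- All fields outside the Saito structure, except `κ` and `Adag`, are proofs; once the data are
  -- identified, proof irrelevance concludes.
  cases S
  cases T
  simp only at h0 hκ hA
  subst h0 hκ hA
  rfl

end HarmonicPotentialRealSaito

namespace PotentialTTStar

variable (T : PotentialTTStar V F E)

theorem g_isReal : T.g.IsReal T.κ := T.h_real.bilin

theorem herm_g : T.g.herm T.κ T.g_isReal = T.h := T.h.herm_bilin T.κ T.h_real

theorem adjOp_Φ : T.h.adjOp T.Φ = T.Adag.dbarEnd :=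
  (T.h.adjOp_eq_iff T.Adag T.Φ).2 (by rw [Adag, T.h.adj_adj, Φ])

theorem Adag_selfAdj : T.g.SelfAdj T.Adag := T.h.selfAdj_adj T.h_real T.A_adj

theorem g_parallel : T.g.IsHolomorphic ∧ T.g.IsParallel T.h.chern :=
  T.h.parallel_of_D_real T.h_real T.D_κ

theorem Φ_selfAdj : T.g.FormSelfAdj T.Φ := T.g_parallel.2.formSelfAdj_dEnd T.A_adj

/-- The dual form of the equation for `D'(Q)` is `d''Q = [Φ^†, U] = [d''A^†, U]`, which equals
`d''[A^†, U]` because `d''U = 0`. -/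
theorem calV_isHolomorphic : T.calV.IsHolomorphic := by
  intro X s
  ext x
  have h1 := (T.h.dEnd_add_comm_eq_zero_iff T.calQ_dag T.Φ).1 T.D_calQ X s x
  rw [T.adjOp_Φ] at h1
  rw [calV, SmoothEnd.dbarEnd_sub, SmoothEnd.dbarEnd_bracket, T.calU_holomorphic.apply,
    T.calU_holomorphic.apply, map_zero, sub_zero, add_zero, h1, sub_self]
  rfl

theorem nabla_op (X : VF V M) (s : Sec V F E) : T.nabla.op X s =
    T.h.chern.op X s + (T.Adag.act (T.Φ.op X s) - T.Φ.op X (T.Adag.act s)) := rfl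

/-- Harmonicity gives `d''D' + D'd'' = -(Φ Φ^† + Φ^† Φ)`. Since `d''Φ = 0` and `d''A^† = Φ^†`, the
correction `[A^†, Φ]` contributes exactly `Φ Φ^† + Φ^† Φ`. -/
theorem nabla_isHolomorphic : T.nabla.IsHolomorphic := by
  intro x₀ v w X Y hX hY s
  have hΦ : T.Φ.IsHolomorphic := T.harmonic.holomorphic
  have h1 := IsHarmonicHiggs.curvature (Φ := T.Φ) T.harmonic hX hY s
  have h2 := congrArg (T.Adag.toFun x₀) (hΦ x₀ v w X Y hX hY s)
  have h3 := hΦ x₀ v w X Y hX hY (T.Adag.act s)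
  rw [T.adjOp_Φ, Form10.op_apply _ _ (T.Adag.dbarEnd X s)] at h1
  simp only [nabla_op, SmoothEnd.dbarEnd_apply, dbarOp_apply, Sec.add_apply, Sec.sub_apply,
    dbar_add, dbar_sub, map_sub, SmoothEnd.act_apply] at h1 h2 h3 ⊢
  simp only [Form10.op_apply, SmoothEnd.act_apply, dbarOp_apply] at h1 h2 h3 ⊢
  linear_combination (norm := module) h1 + h2 - h3

/-- `D'(Φ) = 0` by harmonicity, and the correction contributes `A^†(Φ ∧ Φ) - (Φ ∧ Φ)A^† = 0`. -/
theorem nabla_Φ : T.nabla.FormParallel T.Φ := by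
  intro x₀ v w X Y hX hY s
  have h1 : (T.h.chern.op X (T.Φ.op Y s) - T.Φ.op Y (T.h.chern.op X s)) x₀ =
      (T.h.chern.op Y (T.Φ.op X s) - T.Φ.op X (T.h.chern.op Y s)) x₀ :=
    T.harmonic.chern_parallel x₀ v w X Y hX hY s
  have hw (u : E x₀) : T.Φ.toFun x₀ (X.val x₀) (T.Φ.toFun x₀ (Y.val x₀) u) =
      T.Φ.toFun x₀ (Y.val x₀) (T.Φ.toFun x₀ (X.val x₀) u) :=
    LinearMap.congr_fun (T.harmonic.wedge x₀ (X.val x₀) (Y.val x₀)) u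
  have h2 := congrArg (T.Adag.toFun x₀) (hw (s x₀))
  have h3 := hw (T.Adag.toFun x₀ (s x₀))
  simp only [nabla_op, Sec.add_apply, Sec.sub_apply, SmoothEnd.act_apply, Form10.op_apply,
    map_add, map_sub] at h1 h2 h3 ⊢
  linear_combination (norm := module) h1 + h2 - h3

/-- The harmonic potential real Saito structure associated with a potential `tt*` bundle. -/
noncomputable def toSaito (hflat : T.nabla.IsFlat)
    (hV : ∀ x v, (T.nabla.dEnd T.calV).toFun x v = 0) : HarmonicPotentialRealSaito V F E where
  nabla := T.nabla
  g := T.g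
  Φ := T.Φ
  calU := T.calU
  calV := T.calV
  nabla_holomorphic := T.nabla_isHolomorphic
  g_holomorphic := T.g_parallel.1
  Φ_holomorphic := T.harmonic.holomorphic
  calU_holomorphic := T.calU_holomorphic
  calV_holomorphic := T.calV_isHolomorphic
  -- This field and the next are the only ones that use the two extra hypotheses.
  flat := hflat
  nabla_calV := hV
  wedge := T.harmonic.wedge
  calU_comm := T.calU_comm
  nabla_Φ := T.nabla_Φ
  nabla_calU x v := by
    rw [nabla, T.h.chern.dEnd_sub_comm_eq T.Adag T.calU T.calV T.calQ T.Φ T.calU_comm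
      (SmoothEnd.sub_add_cancel _ _).symm]
    exact T.D_calU x v
  nabla_g := T.g_parallel.2.add_bracket T.Adag_selfAdj T.Φ_selfAdj
  calV_adj := by
    intro x u w
    have h1 : T.g.toFun x (T.calQ.toFun x u) w = -T.g.toFun x u (T.calQ.toFun x w) :=
      T.calQ_adj x u w
    simp only [calV, SmoothEnd.toFun_sub, LinearMap.sub_apply, map_sub, h1,
      T.Adag_selfAdj.bracket_skewAdj T.calU_adj x]
    ring
  Φ_adj := T.Φ_selfAdj
  calU_adj := T.calU_adj
  κ := T.κ
  g_real := T.g_isReal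
  chern_g := by rw [T.herm_g]; exact T.g_parallel.2
  harmonic := by rw [T.herm_g]; exact T.harmonic
  Adag := T.Adag
  Adag_adj := T.Adag_selfAdj
  -- Since `∇ - [A^†, Φ]` is the Chern `D'` and `d''A^†` is `Φ^†`, the next three fields are the
  -- `h`-duals of `d''² = 0`, `d''Φ = 0` and `Φ ∧ Φ = 0`.
  Dprime_flat := by
    rw [nabla, Conn10.add_sub_cancel]
    exact T.h.chern_isFlat
  Dprime_Φdag := by
    rw [nabla, Conn10.add_sub_cancel, ← T.adjOp_Φ]
    exact T.h.chern_adjOp_comm T.harmonic.holomorphic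
  wedge_Φdag := by
    rw [← T.adjOp_Φ]
    exact T.h.adjOp_comm T.harmonic.wedge
  chern_eq := by rw [T.herm_g, nabla, Conn10.add_sub_cancel]
  Φ_dag := by rw [T.herm_g]; exact T.adjOp_Φ
  calQ_dag := by
    rw [T.herm_g, calV, SmoothEnd.sub_add_cancel]
    exact T.calQ_dag

end PotentialTTStar

/-- The correspondence between harmonic potential real Saito structures and potential `tt*` bundles
with `∇² = 0` and `∇(V) = 0`. -/
noncomputable def saitoEquivTTStar : HarmonicPotentialRealSaito V F E ≃
    {T : PotentialTTStar V F E // T.nabla.IsFlat ∧ ∀ x v, (T.nabla.dEnd T.calV).toFun x v = 0} where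
  toFun S := ⟨S.toPotentialTTStar, by
    rw [S.toPotentialTTStar_nabla, S.toPotentialTTStar_calV]
    exact ⟨S.flat, S.nabla_calV⟩⟩
  invFun T := T.1.toSaito T.2.1 T.2.2
  left_inv S := HarmonicPotentialRealSaito.ext_data S.toPotentialTTStar_nabla
    S.toPotentialTTStar_g S.toPotentialTTStar_Φ rfl S.toPotentialTTStar_calV rfl
    S.toPotentialTTStar_Adag
  right_inv T := Subtype.ext (by
    -- Recovering `A` needs `h` first: the adjoint is taken for the form rebuilt from `g` and `κ`,
    -- which `herm_g` identifies with `h`, and then `A^†† = A`.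
    refine PotentialTTStar.ext T.1.herm_g ?_ rfl rfl ?_
    · change (T.1.g.herm T.1.κ _).adj T.1.Adag = T.1.A
      rw [T.1.herm_g]
      exact T.1.h.adj_adj T.1.A
    · exact SmoothEnd.sub_add_cancel _ _)

end Correspondence

end TTStar

theorem mainTheorem6
    {V : Type*} [NormedAddCommGroup V] [NormedSpace ℂ V] [FiniteDimensional ℂ V]
    {M : Type*} [TopologicalSpace M] [T2Space M] [ChartedSpace V M] [IsManifold 𝓘(ℂ, V) ω M]
    {F : Type*} [NormedAddCommGroup F] [NormedSpace ℂ F] [FiniteDimensional ℂ F]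
    {E : M → Type*} [TopologicalSpace (TotalSpace F E)] [∀ x, TopologicalSpace (E x)]
    [∀ x, AddCommGroup (E x)] [∀ x, Module ℂ (E x)] [FiberBundle F E]
    [VectorBundle ℂ F E] [ContMDiffVectorBundle ω F E 𝓘(ℂ, V)] :
    ∃ e : TTStar.HarmonicPotentialRealSaito V F E ≃
        {T : TTStar.PotentialTTStar V F E //
          T.nabla.IsFlat ∧ ∀ x v, (T.nabla.dEnd T.calV).toFun x v = 0},
      (∀ S : TTStar.HarmonicPotentialRealSaito V F E,
        (e S).1.h = S.h ∧ (e S).1.A = S.A ∧ (e S).1.κ = S.κ ∧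
          (e S).1.calU = S.calU ∧ (e S).1.calQ = S.calQ) ∧
      (∀ T, (e.symm T).nabla = T.1.nabla ∧ (e.symm T).g = T.1.g ∧ (e.symm T).Φ = T.1.Φ ∧
        (e.symm T).calU = T.1.calU ∧ (e.symm T).calV = T.1.calV ∧ (e.symm T).κ = T.1.κ ∧
        (e.symm T).Adag = T.1.Adag) :=
  ⟨TTStar.saitoEquivTTStar, fun _ => ⟨rfl, rfl, rfl, rfl, rfl⟩,
    fun _ => ⟨rfl, rfl, rfl, rfl, rfl, rfl, rfl⟩⟩
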